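/- For $\tau,z\in\mathbb C$ with $\operatorname{Im}\tau>0$ put $q^{r}=e^{2\pi i r\tau}$ ($r\in\mathbb C$), and for $a,b\in\{0,1\}$ let $$\vartheta_{ab}(\tau,z)=\sum_{m\in\mathbb Z}e^{\pi i(m+\frac a2)^2\tau+2\pi i(m+\frac a2)(z+\frac b2)}$$ be Mumford's theta functions. Let $n\in\mathbb Z_{\ge 0}$. Each of the following eight formulas holds for all $\tau$ with $\operatorname{Im}\tau>0$ and all $z\in\mathbb C$ for which no denominator in the series on its left-hand side vanishes; under this condition the series converges absolutely and the theta function in the denominator on the right-hand side is nonzero. 1) (i) $\displaystyle 2\sum_{j\in\mathbb Z}\frac{e^{2\pi ijz}q^{\frac12j^2}}{1-e^{2\pi iz}q^{j+n}}=q^{\frac12n^2}\Big\{-i\,\vartheta_{00}(\tau,0)\frac{\vartheta_{01}(\tau,z)\vartheta_{10}(\tau,z)}{\vartheta_{11}(\tau,z)}+\sum_{k=0}^{2n}q^{-\frac12(k-n)^2}\vartheta_{00}(\tau,z)\Big\}$ (ii) $\displaystyle 2\sum_{j\in\mathbb Z}\frac{e^{2\pi i(j-\frac12)z}q^{\frac12(j-\frac12)^2}}{1-e^{2\pi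 iz}q^{j+n}}=q^{\frac12(n+\frac12)^2}\Big\{-i\,\vartheta_{10}(\tau,0)\frac{\vartheta_{01}(\tau,z)\vartheta_{00}(\tau,z)}{\vartheta_{11}(\tau,z)}+\sum_{k=0}^{2n+1}q^{-\frac12(k-n-\frac12)^2}\vartheta_{10}(\tau,z)\Big\}$ (iii) $\displaystyle 2\sum_{j\in\mathbb Z}\frac{e^{2\pi ijz}q^{\frac12j^2}}{1-e^{2\pi iz}q^{j+n+\frac12}}=q^{\frac12(n+\frac12)^2}\Big\{-i\,\vartheta_{10}(\tau,0)\frac{\vartheta_{10}(\tau,z)\vartheta_{11}(\tau,z)}{\vartheta_{01}(\tau,z)}+\sum_{k=0}^{2n+1}q^{-\frac12(k-n-\frac12)^2}\vartheta_{00}(\tau,z)\Big\}$ (iv) $\displaystyle 2\sum_{j\in\mathbb Z}\frac{e^{2\pi i(j+\frac12)z}q^{\frac12(j+\frac12)^2}}{1-e^{2\pi iz}q^{j+n+\frac12}}=q^{\frac12n^2}\Big\{-i\,\vartheta_{00}(\tau,0)\frac{\vartheta_{00}(\tau,z)\vartheta_{11}(\tau,z)}{\vartheta_{01}(\tau,z)}+\sum_{k=0}^{2n}q^{-\frac12(k-n)^2}\vartheta_{10}(\tau,z)\Big\}$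 2) (i) $\displaystyle 2\sum_{j\in\mathbb Z}(-1)^j\frac{e^{2\pi ijz}q^{\frac12j^2}}{1+e^{2\pi iz}q^{j+n}}=q^{\frac12n^2}\Big\{i\,\vartheta_{00}(\tau,0)\frac{\vartheta_{00}(\tau,z)\vartheta_{11}(\tau,z)}{\vartheta_{10}(\tau,z)}+\sum_{k=0}^{2n}q^{-\frac12(k-n)^2}\vartheta_{01}(\tau,z)\Big\}$ (ii) $\displaystyle 2\sum_{j\in\mathbb Z}(-1)^j\frac{e^{2\pi i(j-\frac12)z}q^{\frac12(j-\frac12)^2}}{1+e^{2\pi iz}q^{j+n}}=q^{\frac12(n+\frac12)^2}\Big\{-\vartheta_{10}(\tau,0)\frac{\vartheta_{01}(\tau,z)\vartheta_{00}(\tau,z)}{\vartheta_{10}(\tau,z)}+i\sum_{k=0}^{2n+1}q^{-\frac12(k-n-\frac12)^2}\vartheta_{11}(\tau,z)\Big\}$ (iii) $\displaystyle 2\sum_{j\in\mathbb Z}(-1)^j\frac{e^{2\pi ijz}q^{\frac12j^2}}{1+e^{2\pi iz}q^{j+n+\frac12}}=q^{\frac12(n+\frac12)^2}\Big\{i\,\vartheta_{10}(\tau,0)\frac{\vartheta_{11}(\tau,z)\vartheta_{10}(\tau,z)}{\vartheta_{00}(\tau,z)}+\sum_{k=0}^{2n+1}q^{-\frac12(k-n-\frac12)^2}\vartheta_{01}(\tau,z)\Big\}$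 (iv) $\displaystyle 2\sum_{j\in\mathbb Z}(-1)^j\frac{e^{2\pi i(j+\frac12)z}q^{\frac12(j+\frac12)^2}}{1+e^{2\pi iz}q^{j+n+\frac12}}=q^{\frac12n^2}\Big\{\vartheta_{00}(\tau,0)\frac{\vartheta_{01}(\tau,z)\vartheta_{10}(\tau,z)}{\vartheta_{00}(\tau,z)}-i\sum_{k=0}^{2n}q^{-\frac12(k-n)^2}\vartheta_{11}(\tau,z)\Big\}$ -/

import Mathlib

namespace AppellSum

noncomputable section

/-- Mumford's theta function `ϑ_{ab}(τ, z)`, with half-integral characteristics `a/2`, `b/2`: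
`∑_{m ∈ ℤ} exp(πi (m + a/2)² τ + 2πi (m + a/2)(z + b/2))`. -/
def theta (a b : ℤ) (τ z : ℂ) : ℂ :=
  ∑' m : ℤ, Complex.exp
    (Real.pi * Complex.I * ((m : ℂ) + (a : ℂ) / 2) ^ 2 * τ
      + 2 * Real.pi * Complex.I * ((m : ℂ) + (a : ℂ) / 2) * (z + (b : ℂ) / 2))

/-- `e(w) = exp(2πi w)`. -/
def e (w : ℂ) : ℂ := Complex.exp (2 * Real.pi * Complex.I * w)

/-- The power `q^r` for `q = exp(2πi τ)`, that is `exp(2πi r τ)` (no branch choice involved). -/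
def qpow (τ r : ℂ) : ℂ := Complex.exp (2 * Real.pi * Complex.I * r * τ)

end

end AppellSum

/-!
Write `A_s(z) = ∑_j e((j + s) z) q ^ (j² / 2 + s j) / (1 - e(z) q ^ j)` with `2 s` an integer.
Reflecting `j` shows that `A_s + A_{1-s}` is odd, and it has the same multipliers under `z ↦ z + 1`
and `z ↦ z + τ` as the theta quotient `-i ϑ_{a0}(0) ϑ₀₁(z) ϑ_{1-a,0}(z) / ϑ₁₁(z)`, `a ≡ 2 s mod 2`.
Both have only simple poles, at the lattice points, and the residues at `0` agree by Jacobi's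
derivative formula `ϑ₁₁'(0) = -π ϑ₀₀(0) ϑ₀₁(0) ϑ₁₀(0)`, a consequence of the triple product. So the
difference extends to `0` and, being odd, vanishes there; the square of its ratio with `ϑ₁₁` is
elliptic without poles, hence constant by Liouville, and it is `0` at `τ / 2` by oddness and
quasi-periodicity.

On the other hand the denominators cancel in `A_s - A_{s+1}`, which is a multiple of `ϑ_{a0}`.
Telescoping from `s = -c / 2` to `1 - s = c / 2 + 1` gives the finite sums. This proves formulas
1 (i) and 1 (ii); the other six follow by translating `z` by `τ / 2` and by `1 / 2`.
-/

namespace AppellSum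

open Filter Topology

noncomputable section

section FiniteProducts

variable {R : Type*} [CommRing R]

/-- The finite `q`-Pochhammer symbol `(a; q)ₙ`. -/
def qPochhammer (a q : R) (n : ℕ) : R := ∏ k ∈ Finset.range n, (1 - a * q ^ k)

/-- The Gaussian binomial coefficient, defined by its Pascal recursion so that it makes sense over
rings in which the `q`-factorials are not invertible. -/
def qBinomial (q : R) : ℕ → ℕ → R
  | _, 0 => 1
  | 0, _ + 1 => 0
  | n + 1, k + 1 => qBinomial q n (k + 1) + q ^ (n - k) * qBinomial q n k

lemma qPochhammer_succ (a q : R) (n : ℕ) :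
    qPochhammer a q (n + 1) = qPochhammer a q n * (1 - a * q ^ n) :=
  Finset.prod_range_succ _ n

lemma qPochhammer_add (a q : R) (m n : ℕ) :
    qPochhammer a q (m + n) = qPochhammer a q m * qPochhammer (a * q ^ m) q n := by
  simp only [qPochhammer, Finset.prod_range_add, pow_add, mul_assoc]

lemma qBinomial_zero_right (q : R) (n : ℕ) : qBinomial q n 0 = 1 := by
  cases n <;> rfl

lemma qBinomial_eq_zero_of_lt (q : R) : ∀ {n k : ℕ}, n < k → qBinomial q n k = 0
  | 0, _ + 1, _ => rfl
  | n + 1, k + 1, h => by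
    rw [qBinomial, qBinomial_eq_zero_of_lt q (by omega : n < k + 1),
      qBinomial_eq_zero_of_lt q (by omega : n < k), mul_zero, add_zero]

lemma qBinomial_mul_qPochhammer_self (q : R) : ∀ k l : ℕ,
    qBinomial q (k + l) k * (qPochhammer q q k * qPochhammer q q l) = qPochhammer q q (k + l)
  | 0, l => by simp [qBinomial_zero_right, qPochhammer]
  | k + 1, 0 => by
    have h := qBinomial_mul_qPochhammer_self q k 0
    simp only [add_zero] at h ⊢
    rw [qBinomial, qBinomial_eq_zero_of_lt q (Nat.lt_succ_self k), qPochhammer_succ, Nat.sub_self]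
    linear_combination (1 - q ^ (k + 1)) * h
  | k + 1, l + 1 => by
    have h₁ := qBinomial_mul_qPochhammer_self q (k + 1) l
    have h₂ := qBinomial_mul_qPochhammer_self q k (l + 1)
    rw [show k + 1 + l = k + l + 1 by ring] at h₁
    rw [← add_assoc] at h₂
    rw [show k + 1 + (l + 1) = k + l + 1 + 1 by ring, qBinomial,
      show k + l + 1 - k = l + 1 by omega]
    simp only [qPochhammer_succ q q (k + l + 1), qPochhammer_succ q q k,
      qPochhammer_succ q q l] at h₁ h₂ ⊢
    linear_combination (1 - q ^ (l + 1)) * h₁ + q ^ (l + 1) * (1 - q ^ (k + 1)) * h₂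

theorem qPochhammer_neg_eq_sum_qBinomial (y q : R) (n : ℕ) :
    qPochhammer (-y) q n
      = ∑ k ∈ Finset.range (n + 1), qBinomial q n k * q ^ k.choose 2 * y ^ k := by
  induction n with
  | zero => simp [qBinomial, qPochhammer]
  | succ n ih =>
    have pascal : ∀ k ∈ Finset.range (n + 1),
        qBinomial q (n + 1) (k + 1) * q ^ (k + 1).choose 2 * y ^ (k + 1)
          = qBinomial q n (k + 1) * q ^ (k + 1).choose 2 * y ^ (k + 1)
            + qBinomial q n k * q ^ k.choose 2 * y ^ k * (y * q ^ n) := fun k hk => by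
      have hk : k ≤ n := Nat.lt_succ_iff.1 (Finset.mem_range.1 hk)
      rw [qBinomial, Nat.choose_succ_succ' k 1, Nat.choose_one_right, ← Nat.sub_add_cancel hk,
        Nat.add_sub_cancel]
      ring
    have low : ∑ k ∈ Finset.range (n + 1),
        qBinomial q n (k + 1) * q ^ (k + 1).choose 2 * y ^ (k + 1) + 1
          = qPochhammer (-y) q n := by
      rw [ih, Finset.sum_range_succ _ n, Finset.sum_range_succ' _ n,
        qBinomial_eq_zero_of_lt q (Nat.lt_succ_self n)]
      simp [qBinomial_zero_right]
    rw [Finset.sum_range_succ' _ (n + 1), Finset.sum_congr rfl pascal, Finset.sum_add_distrib,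
      ← Finset.sum_mul, ← ih, qPochhammer_succ]
    simp only [qBinomial_zero_right, Nat.choose_zero_succ, pow_zero, mul_one]
    linear_combination -low

end FiniteProducts

section FiniteTripleProduct

lemma sq_pow_choose_two_mul_pow {M : Type*} [Monoid M] (x : M) (k : ℕ) :
    (x ^ 2) ^ k.choose 2 * x ^ k = x ^ k ^ 2 := by
  rw [← pow_mul, ← pow_add, Nat.choose_two_right,
    Nat.mul_div_cancel' (Nat.even_mul_pred_self k).two_dvd, Nat.mul_sub_one,
    Nat.sub_add_cancel (Nat.le_mul_self k), sq]

variable {K : Type*} [Field K]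

lemma qPochhammer_reverse {a q : K} (ha : a ≠ 0) (hq : q ≠ 0) (n : ℕ) :
    qPochhammer a q n = (-a) ^ n * q ^ n.choose 2 * qPochhammer (q / (a * q ^ n)) q n := by
  have hfactor : ∀ k ∈ Finset.range n,
      1 - a * q ^ k = -a * q ^ k * (1 - q / (a * q ^ n) * q ^ (n - 1 - k)) := fun k hk => by
    obtain ⟨d, rfl⟩ : ∃ d, n = k + d + 1 :=
      Nat.exists_eq_add_of_lt (Finset.mem_range.1 hk)
    rw [show k + d + 1 - 1 - k = d by omega]
    field_simp
    ring
  rw [qPochhammer, Finset.prod_congr rfl hfactor, Finset.prod_mul_distrib, Finset.prod_mul_distrib,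
    Finset.prod_range_reflect (fun k => 1 - q / (a * q ^ n) * q ^ k), Finset.prod_const,
    Finset.card_range, Finset.prod_pow_eq_pow_sum, Finset.sum_range_id, Nat.choose_two_right,
    qPochhammer]

theorem qPochhammer_mul_qPochhammer_eq_sum {x y : K} (hx : x ≠ 0) (hy : y ≠ 0) (n : ℕ) :
    qPochhammer (-(x * y)) (x ^ 2) n * qPochhammer (-(x / y)) (x ^ 2) n
      = ∑ j ∈ Finset.Icc (-n : ℤ) n,
          qBinomial (x ^ 2) (2 * n) (n + j).toNat * (x ^ j ^ 2 * y ^ j) := by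
  have hterm : ∀ k : ℕ,
      (x / y) ^ n * (x ^ 2) ^ n.choose 2 * ((x ^ 2) ^ k.choose 2 * (x * y / (x ^ 2) ^ n) ^ k)
        = x ^ ((k - n : ℤ) ^ 2) * y ^ (k - n : ℤ) := fun k => by
    have hn := sq_pow_choose_two_mul_pow x n
    have hk := sq_pow_choose_two_mul_pow x k
    rw [sub_sq, zpow_add₀ hx, zpow_sub₀ hx, zpow_sub₀ hy]
    norm_cast
    rw [← hn, ← hk, div_pow, div_pow, mul_pow]
    field_simp
    ring
  have hjoin : qPochhammer (-(x * y)) (x ^ 2) n * qPochhammer (-(x / y)) (x ^ 2) n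
      = (x / y) ^ n * (x ^ 2) ^ n.choose 2
        * qPochhammer (-(x * y / (x ^ 2) ^ n)) (x ^ 2) (2 * n) := by
    have hreverse : x ^ 2 / (-(x / y) * (x ^ 2) ^ n) = -(x * y / (x ^ 2) ^ n) := by field_simp
    have hshift : -(x * y / (x ^ 2) ^ n) * (x ^ 2) ^ n = -(x * y) := by field_simp
    rw [qPochhammer_reverse (neg_ne_zero.2 (div_ne_zero hx hy)) (pow_ne_zero 2 hx), hreverse,
      neg_neg, two_mul, qPochhammer_add, hshift]
    ring
  rw [hjoin, qPochhammer_neg_eq_sum_qBinomial, Finset.mul_sum]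
  refine Finset.sum_nbij' (fun k => (k : ℤ) - n) (fun j => (n + j).toNat) ?_ ?_ ?_ ?_ ?_
  · simp only [Finset.mem_range, Finset.mem_Icc]; omega
  · simp only [Finset.mem_range, Finset.mem_Icc]; omega
  · simp
  · simp only [Finset.mem_Icc]; omega
  · intro k _
    rw [add_sub_cancel, Int.toNat_natCast, ← hterm]
    ring

end FiniteTripleProduct

section InfiniteProducts

variable {K : Type*} [NormedField K] {a q : K}

/-- The infinite `q`-Pochhammer symbol `(a; q)_∞`, meaningful for `‖q‖ < 1`. -/
def qPochhammerInf (a q : K) : K := ∏' n : ℕ, (1 - a * q ^ n)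

lemma summable_norm_neg_mul_pow (a : K) (hq : ‖q‖ < 1) :
    Summable fun n : ℕ => ‖-(a * q ^ n)‖ := by
  simp only [norm_neg, norm_mul, norm_pow]
  exact (summable_geometric_of_lt_one (norm_nonneg q) hq).mul_left _

lemma one_sub_mul_pow_ne_zero (ha : ‖a‖ < 1) (hq : ‖q‖ < 1) (n : ℕ) : 1 - a * q ^ n ≠ 0 := by
  intro h
  have hlt : ‖a * q ^ n‖ < 1 := by
    rw [norm_mul, norm_pow]
    exact mul_lt_one_of_nonneg_of_lt_one_left (norm_nonneg a) ha
      (pow_le_one₀ (norm_nonneg q) hq.le)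
  rw [← sub_eq_zero.1 h, norm_one] at hlt
  exact lt_irrefl 1 hlt

lemma qPochhammer_ne_zero (ha : ‖a‖ < 1) (hq : ‖q‖ < 1) (n : ℕ) : qPochhammer a q n ≠ 0 :=
  Finset.prod_ne_zero_iff.2 fun k _ => one_sub_mul_pow_ne_zero ha hq k

lemma qBinomial_eq_div (hq : ‖q‖ < 1) (k l : ℕ) :
    qBinomial q (k + l) k
      = qPochhammer q q (k + l) / (qPochhammer q q k * qPochhammer q q l) :=
  eq_div_of_mul_eq (mul_ne_zero (qPochhammer_ne_zero hq hq k) (qPochhammer_ne_zero hq hq l))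
    (qBinomial_mul_qPochhammer_self q k l)

variable [CompleteSpace K]

lemma multipliable_one_sub_mul_pow (a : K) (hq : ‖q‖ < 1) :
    Multipliable fun n : ℕ => 1 - a * q ^ n := by
  simpa only [sub_eq_add_neg] using
    multipliable_one_add_of_summable (summable_norm_neg_mul_pow a hq)

lemma tendsto_qPochhammer (a : K) (hq : ‖q‖ < 1) :
    Tendsto (qPochhammer a q) atTop (𝓝 (qPochhammerInf a q)) :=
  (multipliable_one_sub_mul_pow a hq).hasProd.tendsto_prod_nat

lemma qPochhammerInf_ne_zero (hq : ‖q‖ < 1) (h : ∀ n : ℕ, 1 - a * q ^ n ≠ 0) :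
    qPochhammerInf a q ≠ 0 := by
  simp only [sub_eq_add_neg] at h
  simpa only [qPochhammerInf, sub_eq_add_neg] using
    tprod_one_add_ne_zero_of_summable h (summable_norm_neg_mul_pow a hq)

lemma qPochhammerInf_self_ne_zero (hq : ‖q‖ < 1) : qPochhammerInf q q ≠ 0 :=
  qPochhammerInf_ne_zero hq (one_sub_mul_pow_ne_zero hq hq)

lemma qPochhammerInf_eq_mul (a : K) (hq : ‖q‖ < 1) :
    qPochhammerInf a q = (1 - a) * qPochhammerInf (a * q) q := by
  have hshift : ∀ n : ℕ, 1 - a * q ^ (n + 1) = 1 - a * q * q ^ n := fun n => by ring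
  have hm : Multipliable fun n : ℕ => 1 - a * q ^ (n + 1) := by
    simpa only [hshift] using multipliable_one_sub_mul_pow (a * q) hq
  simp only [qPochhammerInf]
  rw [tprod_eq_zero_mul' (f := fun n => 1 - a * q ^ n) hm]
  simp only [hshift, pow_zero, mul_one]

/-- The first two factors multiply to the `(x²; x⁴)_∞` of Euler's identity. -/
theorem qPochhammerInf_euler {x : K} (hx : ‖x‖ < 1) :
    qPochhammerInf x (x ^ 2) * qPochhammerInf (-x) (x ^ 2) * qPochhammerInf (-x ^ 2) (x ^ 2)
      = 1 := by
  have hq : ‖x ^ 2‖ < 1 := by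
    rw [norm_pow]; exact pow_lt_one₀ (norm_nonneg x) hx two_ne_zero
  have hm (a : K) := multipliable_one_sub_mul_pow a hq
  have hodd := (hm x).mul (hm (-x))
  have heven := (hm (-x ^ 2)).mul (hm (x ^ 2))
  have hodd_mul : ∀ n : ℕ, (1 - x * (x ^ 2) ^ n) * (1 - -x * (x ^ 2) ^ n)
      = 1 - x ^ 2 * (x ^ 2) ^ (2 * n) := fun n => by ring
  have heven_mul : ∀ n : ℕ, (1 - -x ^ 2 * (x ^ 2) ^ n) * (1 - x ^ 2 * (x ^ 2) ^ n)
      = 1 - x ^ 2 * (x ^ 2) ^ (2 * n + 1) := fun n => by ring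
  refine mul_right_cancel₀ (qPochhammerInf_self_ne_zero hq) ?_
  rw [one_mul, mul_assoc]
  simp only [qPochhammerInf]
  rw [← (hm x).tprod_mul (hm (-x)), ← (hm (-x ^ 2)).tprod_mul (hm (x ^ 2))]
  simp only [hodd_mul, heven_mul] at hodd heven ⊢
  exact tprod_even_mul_odd (f := fun n => 1 - x ^ 2 * (x ^ 2) ^ n) hodd heven

end InfiniteProducts

section Continuity

variable {K : Type*} [NormedField K] [ProperSpace K] {q : K}

lemma continuous_qPochhammerInf (hq : ‖q‖ < 1) :
    Continuous fun a : K => qPochhammerInf a q := by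
  refine continuous_iff_continuousAt.2 fun a => ?_
  have hbound : ∀ (n : ℕ), ∀ b ∈ Metric.closedBall a 1, ‖-(b * q ^ n)‖ ≤ (‖a‖ + 1) * ‖q‖ ^ n :=
    fun n b hb => by
      rw [norm_neg, norm_mul, norm_pow]
      gcongr
      exact norm_le_of_mem_closedBall hb
  have hunif := (Summable.multipliableUniformlyOn_nat_one_add (isCompact_closedBall a 1)
    ((summable_geometric_of_lt_one (norm_nonneg q) hq).mul_left (‖a‖ + 1))
    (Eventually.of_forall hbound) (fun n => by fun_prop)).hasProdUniformlyOn
  simp only [← sub_eq_add_neg] at hunif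
  exact (hunif.tendstoUniformlyOn.continuousOn
    (Eventually.of_forall fun s => by fun_prop).frequently).continuousAt
      (Metric.closedBall_mem_nhds a one_pos)

end Continuity

section GaussianSummability

variable {K : Type*} [NormedField K] {x : K}

lemma summable_norm_pow_sq_mul_pow (hx : ‖x‖ < 1) (y : K) :
    Summable fun n : ℕ => ‖x ^ n ^ 2 * y ^ n‖ := by
  have hlim : Tendsto (fun n : ℕ => ‖x ^ n * y‖) atTop (𝓝 0) := by
    simpa using ((tendsto_pow_atTop_nhds_zero_of_norm_lt_one hx).mul_const y).norm
  refine summable_geometric_two.of_norm_bounded_eventually_nat ?_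
  filter_upwards [hlim.eventually_le_const one_half_pos] with n hn
  rw [sq, pow_mul, ← mul_pow, norm_norm, norm_pow]
  gcongr

lemma summable_norm_zpow_sq_mul_zpow (hx : ‖x‖ < 1) (y : K) :
    Summable fun j : ℤ => ‖x ^ j ^ 2 * y ^ j‖ := by
  refine .of_nat_of_neg ?_ ?_
  · exact_mod_cast summable_norm_pow_sq_mul_pow hx y
  · simp only [neg_sq, zpow_neg, ← inv_zpow]
    exact_mod_cast summable_norm_pow_sq_mul_pow hx y⁻¹

end GaussianSummability

section TripleProduct

variable {K : Type*} [NormedField K] [CompleteSpace K] {q x y : K}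

lemma tendsto_qBinomial (hq : ‖q‖ < 1) {ι : Type*} {F : Filter ι} {k l : ι → ℕ}
    (hk : Tendsto k F atTop) (hl : Tendsto l F atTop) :
    Tendsto (fun i => qBinomial q (k i + l i) (k i)) F (𝓝 (qPochhammerInf q q)⁻¹) := by
  have hlim := tendsto_qPochhammer q hq
  have h0 := qPochhammerInf_self_ne_zero hq
  simp only [qBinomial_eq_div hq]
  rw [← div_mul_cancel_left₀ h0 (qPochhammerInf q q)]
  exact (hlim.comp (tendsto_atTop_mono (fun i => Nat.le_add_right _ (l i)) hk)).div
    ((hlim.comp hk).mul (hlim.comp hl)) (mul_ne_zero h0 h0)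

lemma exists_norm_qBinomial_le (hq : ‖q‖ < 1) : ∃ C : ℝ, ∀ n k : ℕ, ‖qBinomial q n k‖ ≤ C := by
  have hlim := tendsto_qPochhammer q hq
  obtain ⟨A, hA⟩ := hlim.norm.bddAbove_range
  obtain ⟨B, hB⟩ := (hlim.inv₀ (qPochhammerInf_self_ne_zero hq)).norm.bddAbove_range
  have hA (m) : ‖qPochhammer q q m‖ ≤ A := hA ⟨m, rfl⟩
  have hB (m) : ‖(qPochhammer q q m)⁻¹‖ ≤ B := hB ⟨m, rfl⟩
  have hA₀ : 0 ≤ A := (norm_nonneg _).trans (hA 0)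
  have hB₀ : 0 ≤ B := (norm_nonneg _).trans (hB 0)
  refine ⟨A * (B * B), fun n k => ?_⟩
  rcases lt_or_ge n k with hnk | hkn
  · rw [qBinomial_eq_zero_of_lt q hnk, norm_zero]
    positivity
  · obtain ⟨l, rfl⟩ := Nat.exists_eq_add_of_le hkn
    rw [qBinomial_eq_div hq, div_eq_mul_inv, mul_inv, norm_mul, norm_mul]
    gcongr
    exacts [hA _, hB _, hB _]

lemma tendsto_qBinomial_two_mul (hq : ‖q‖ < 1) (j : ℤ) :
    Tendsto (fun n : ℕ => qBinomial q (2 * n) (n + j).toNat) atTop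
      (𝓝 (qPochhammerInf q q)⁻¹) := by
  have hk : Tendsto (fun n : ℕ => (n + j).toNat) atTop atTop := tendsto_atTop.2 fun b => by
    filter_upwards [eventually_ge_atTop (b + j.natAbs)] with n hn; omega
  have hl : Tendsto (fun n : ℕ => (n - j).toNat) atTop atTop := tendsto_atTop.2 fun b => by
    filter_upwards [eventually_ge_atTop (b + j.natAbs)] with n hn; omega
  refine (tendsto_qBinomial hq hk hl).congr' ?_
  filter_upwards [eventually_ge_atTop j.natAbs] with n hn
  rw [show (n + j).toNat + (n - j).toNat = 2 * n by omega]

theorem tsum_zpow_sq_mul_zpow (hx : ‖x‖ < 1) (hx₀ : x ≠ 0) (hy : y ≠ 0) :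
    ∑' j : ℤ, x ^ j ^ 2 * y ^ j
      = qPochhammerInf (x ^ 2) (x ^ 2) * qPochhammerInf (-(x * y)) (x ^ 2)
        * qPochhammerInf (-(x / y)) (x ^ 2) := by
  have hq : ‖x ^ 2‖ < 1 := by
    rw [norm_pow]; exact pow_lt_one₀ (norm_nonneg x) hx two_ne_zero
  let f (n : ℕ) : ℤ → K := (Finset.Icc (-n : ℤ) n : Set ℤ).indicator fun j =>
    qBinomial (x ^ 2) (2 * n) (n + j).toNat * (x ^ j ^ 2 * y ^ j)
  have hfinite (n : ℕ) : ∑' j, f n j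
      = qPochhammer (-(x * y)) (x ^ 2) n * qPochhammer (-(x / y)) (x ^ 2) n := by
    rw [qPochhammer_mul_qPochhammer_eq_sum hx₀ hy, ← sum_eq_tsum_indicator]
  have hpointwise (j : ℤ) : Tendsto (f · j) atTop
      (𝓝 ((qPochhammerInf (x ^ 2) (x ^ 2))⁻¹ * (x ^ j ^ 2 * y ^ j))) := by
    refine ((tendsto_qBinomial_two_mul hq j).mul_const _).congr' ?_
    filter_upwards [eventually_ge_atTop j.natAbs] with n hn
    have hj : j ∈ Finset.Icc (-n : ℤ) n := Finset.mem_Icc.2 (by omega)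
    simp only [f, Set.indicator_of_mem (Finset.mem_coe.2 hj)]
  obtain ⟨C, hC⟩ := exists_norm_qBinomial_le hq
  have hbound (n : ℕ) (j : ℤ) : ‖f n j‖ ≤ C * ‖x ^ j ^ 2 * y ^ j‖ := by
    refine (norm_indicator_le_norm_self _ j).trans ?_
    rw [norm_mul]
    gcongr
    exact hC _ _
  have hlim := tendsto_tsum_of_dominated_convergence
    ((summable_norm_zpow_sq_mul_zpow hx y).mul_left C) hpointwise (Eventually.of_forall hbound)
  simp only [hfinite] at hlim
  have h := tendsto_nhds_unique hlim ((tendsto_qPochhammer _ hq).mul (tendsto_qPochhammer _ hq))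
  rw [tsum_mul_left, inv_mul_eq_iff_eq_mul₀ (qPochhammerInf_self_ne_zero hq)] at h
  rw [h, mul_assoc]

end TripleProduct

section Exponential

lemma e_add (u v : ℂ) : e (u + v) = e u * e v := by
  rw [e, e, e, ← Complex.exp_add, mul_add]

lemma e_neg (u : ℂ) : e (-u) = (e u)⁻¹ := by
  rw [e, e, ← Complex.exp_neg, mul_neg]

lemma e_sub (u v : ℂ) : e (u - v) = e u / e v := by
  rw [sub_eq_add_neg, e_add, e_neg, div_eq_mul_inv]

lemma e_ne_zero (u : ℂ) : e u ≠ 0 := Complex.exp_ne_zero _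

lemma e_zero : e 0 = 1 := by rw [e, mul_zero, Complex.exp_zero]

lemma e_int (n : ℤ) : e n = 1 := by
  rw [e, mul_comm]
  exact Complex.exp_int_mul_two_pi_mul_I n

lemma e_half : e (1 / 2) = -1 := by
  rw [e, show 2 * Real.pi * Complex.I * (1 / 2) = Real.pi * Complex.I by ring, Complex.exp_pi_mul_I]

lemma e_quarter : e (1 / 4) = Complex.I := by
  rw [e, show 2 * Real.pi * Complex.I * (1 / 4) = Real.pi / 2 * Complex.I by ring,
    Complex.exp_pi_div_two_mul_I]

lemma e_add_int (u : ℂ) (n : ℤ) : e (u + n) = e u := by rw [e_add, e_int, mul_one]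

lemma e_add_half (u : ℂ) : e (u + 1 / 2) = -e u := by rw [e_add, e_half, mul_neg_one]

lemma e_sub_half (u : ℂ) : e (u - 1 / 2) = -e u := by rw [e_sub, e_half, div_neg, div_one]

lemma e_int_mul (n : ℤ) (u : ℂ) : e (n * u) = e u ^ n := by
  rw [e, e, ← Complex.exp_int_mul, mul_left_comm]

lemma e_nat_mul (n : ℕ) (u : ℂ) : e (n * u) = e u ^ n := by
  simpa using e_int_mul n u

lemma qpow_eq_e (τ r : ℂ) : qpow τ r = e (r * τ) := by
  rw [qpow, e, ← mul_assoc]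

lemma e_eq_one_iff (u : ℂ) : e u = 1 ↔ ∃ n : ℤ, u = n := by
  rw [e, Complex.exp_eq_one_iff]
  refine exists_congr fun n => ?_
  rw [mul_comm, mul_left_inj' Complex.two_pi_I_ne_zero]

lemma norm_e (u : ℂ) : ‖e u‖ = Real.exp (-(2 * Real.pi * u.im)) := by
  rw [e, Complex.norm_exp]
  simp

lemma norm_e_lt_one {u : ℂ} (hu : 0 < u.im) : ‖e u‖ < 1 := by
  rw [norm_e, Real.exp_lt_one_iff, neg_lt_zero]
  positivity

lemma differentiable_e : Differentiable ℂ e := by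
  unfold e
  fun_prop

lemma hasDerivAt_e_zero : HasDerivAt e (2 * Real.pi * Complex.I) 0 := by
  have h := ((hasDerivAt_id (0 : ℂ)).const_mul (2 * Real.pi * Complex.I)).cexp
  rw [funext fun w => show e w = Complex.exp (2 * Real.pi * Complex.I * w) from rfl]
  simpa using h

lemma tendsto_one_sub_e_div :
    Tendsto (fun z => (1 - e z) / z) (𝓝[≠] 0) (𝓝 (-(2 * Real.pi * Complex.I))) := by
  refine (hasDerivAt_iff_tendsto_slope_zero.1 hasDerivAt_e_zero).neg.congr fun z => ?_
  rw [zero_add, e_zero, smul_eq_mul]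
  ring

end Exponential

section QuasiPeriods

variable (a b : ℤ) (τ z : ℂ)

lemma theta_eq_tsum_e :
    theta a b τ z = ∑' m : ℤ,
      e ((m + a / 2 : ℂ) ^ 2 / 2 * τ + (m + a / 2 : ℂ) * (z + b / 2)) := by
  rw [theta]
  refine tsum_congr fun m => ?_
  rw [e]
  ring_nf

lemma jacobiTheta₂_term_eq_e (n : ℤ) :
    jacobiTheta₂_term n z τ = e (n * z + (n : ℂ) ^ 2 / 2 * τ) := by
  rw [jacobiTheta₂_term, e]
  ring_nf

lemma theta_eq_jacobiTheta₂ :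
    theta a b τ z
      = e ((a : ℂ) ^ 2 / 8 * τ + a / 2 * (z + b / 2)) * jacobiTheta₂ (z + b / 2 + a / 2 * τ) τ := by
  rw [theta_eq_tsum_e, jacobiTheta₂, ← tsum_mul_left]
  refine tsum_congr fun m => ?_
  rw [jacobiTheta₂_term_eq_e, ← e_add]
  ring_nf

lemma theta_add_half : theta a b τ (z + 1 / 2) = theta a (b + 1) τ z := by
  rw [theta_eq_tsum_e, theta_eq_tsum_e]
  refine tsum_congr fun m => ?_
  push_cast
  ring_nf

lemma theta_add_tau_half :
    theta a b τ (z + 1 / 2 * τ)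
      = e (-(1 / 8 * τ) - 1 / 2 * z - b / 4) * theta (a + 1) b τ z := by
  rw [theta_eq_tsum_e, theta_eq_tsum_e, ← tsum_mul_left]
  refine tsum_congr fun m => ?_
  rw [← e_add]
  push_cast
  ring_nf

lemma theta_add_two_mul_left (k : ℤ) : theta (a + 2 * k) b τ z = theta a b τ z := by
  rw [theta_eq_tsum_e, theta_eq_tsum_e, eq_comm, ← (Equiv.addRight k).tsum_eq]
  refine tsum_congr fun m => ?_
  rw [Equiv.coe_addRight]
  push_cast
  ring_nf

lemma theta_add_two_right : theta a (b + 2) τ z = e (a / 2) * theta a b τ z := by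
  rw [theta_eq_tsum_e, theta_eq_tsum_e, ← tsum_mul_left]
  refine tsum_congr fun m => ?_
  rw [← e_add, ← e_add_int (_ / _ + _) m]
  push_cast
  ring_nf

lemma theta_add_one : theta a b τ (z + 1) = e (a / 2) * theta a b τ z := by
  rw [← theta_add_two_right, show z + 1 = z + 1 / 2 + 1 / 2 by ring, theta_add_half,
    theta_add_half, add_assoc, one_add_one_eq_two]

lemma theta_add_tau :
    theta a b τ (z + τ) = e (-z - b / 2 - 1 / 2 * τ) * theta a b τ z := by
  rw [show z + τ = z + 1 / 2 * τ + 1 / 2 * τ by ring, theta_add_tau_half, theta_add_tau_half,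
    ← theta_add_two_mul_left a b τ z 1, ← mul_assoc, ← e_add, add_assoc, one_add_one_eq_two,
    mul_one]
  ring_nf

lemma theta_neg : theta a b τ (-z) = e (-(a * b) / 2) * theta a b τ z := by
  rw [theta_eq_tsum_e, theta_eq_tsum_e, ← tsum_mul_left, ← (Equiv.subLeft (-a)).tsum_eq]
  refine tsum_congr fun m => ?_
  rw [Equiv.subLeft_apply, ← e_add, ← e_add_int (_ / _ + _) (-(b * m))]
  push_cast
  ring_nf

lemma theta_one_one_neg : theta 1 1 τ (-z) = -theta 1 1 τ z := by
  rw [theta_neg, show (-((1 : ℤ) * (1 : ℤ)) / 2 : ℂ) = 0 - 1 / 2 by norm_num, e_sub_half, e_zero,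
    neg_one_mul]

lemma theta_zero_right_neg : theta a 0 τ (-z) = theta a 0 τ z := by
  rw [theta_neg, Int.cast_zero, mul_zero, neg_zero, zero_div, e_zero, one_mul]

lemma theta_zero_left_neg : theta 0 b τ (-z) = theta 0 b τ z := by
  rw [theta_neg, Int.cast_zero, zero_mul, neg_zero, zero_div, e_zero, one_mul]

end QuasiPeriods

section ProductFormulas

variable {τ : ℂ}

lemma differentiable_theta (hτ : 0 < τ.im) (a b : ℤ) : Differentiable ℂ (theta a b τ) := by
  intro z
  have h_series : DifferentiableAt ℂ (fun z : ℂ => jacobiTheta₂ (z + b / 2 + a / 2 * τ) τ) z :=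
    (differentiableAt_jacobiTheta₂_fst _ hτ).comp z (by fun_prop)
  have h_factor : DifferentiableAt ℂ
      (fun z : ℂ => e ((a : ℂ) ^ 2 / 8 * τ + a / 2 * (z + b / 2))) z :=
    differentiable_e.differentiableAt.comp z (by fun_prop)
  rw [funext (theta_eq_jacobiTheta₂ a b τ)]
  exact h_factor.mul h_series

lemma e_half_mul_sq (τ : ℂ) : e (1 / 2 * τ) ^ 2 = e τ := by
  rw [← e_nat_mul]
  ring_nf

lemma norm_e_half_mul_lt_one (hτ : 0 < τ.im) : ‖e (1 / 2 * τ)‖ < 1 :=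
  norm_e_lt_one (by simpa using hτ)

theorem jacobiTheta₂_eq_qPochhammerInf (hτ : 0 < τ.im) (z : ℂ) :
    jacobiTheta₂ z τ = qPochhammerInf (e τ) (e τ) * qPochhammerInf (-e (1 / 2 * τ + z)) (e τ)
      * qPochhammerInf (-e (1 / 2 * τ - z)) (e τ) := by
  have hterm (j : ℤ) : jacobiTheta₂_term j z τ = e (1 / 2 * τ) ^ (j ^ 2) * e z ^ j := by
    rw [jacobiTheta₂_term_eq_e, ← e_int_mul, ← e_int_mul, ← e_add]
    push_cast
    ring_nf
  rw [jacobiTheta₂, tsum_congr hterm, tsum_zpow_sq_mul_zpow (norm_e_half_mul_lt_one hτ)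
    (e_ne_zero _) (e_ne_zero _), e_half_mul_sq, ← e_add, ← e_sub]

theorem theta_one_one_eq_qPochhammerInf (hτ : 0 < τ.im) (z : ℂ) :
    theta 1 1 τ z = -(Complex.I * e (1 / 8 * τ - 1 / 2 * z)) * (1 - e z) *
      (qPochhammerInf (e τ) (e τ) * qPochhammerInf (e (z + τ)) (e τ) *
        qPochhammerInf (e (-z + τ)) (e τ)) := by
  have h_plus : -e (1 / 2 * τ + (z + (1 : ℤ) / 2 + (1 : ℤ) / 2 * τ)) = e (z + τ) := by
    rw [← e_add_half, ← e_add_int (z + τ) 1]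
    push_cast
    ring_nf
  have h_minus : -e (1 / 2 * τ - (z + (1 : ℤ) / 2 + (1 : ℤ) / 2 * τ)) = e (-z) := by
    rw [← e_add_half]
    push_cast
    ring_nf
  have h_factor : e (((1 : ℤ) : ℂ) ^ 2 / 8 * τ + (1 : ℤ) / 2 * (z + (1 : ℤ) / 2))
      = Complex.I * e (1 / 8 * τ - 1 / 2 * z) * e z := by
    rw [← e_quarter, ← e_add, ← e_add]
    push_cast
    ring_nf
  rw [theta_eq_jacobiTheta₂, jacobiTheta₂_eq_qPochhammerInf hτ, h_plus, h_minus, h_factor,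
    qPochhammerInf_eq_mul (e (-z)) (norm_e_lt_one hτ), ← e_add, e_neg]
  field_simp [e_ne_zero z]
  ring

theorem theta_zero_zero_mul_theta_zero_one_mul_theta_one_zero (hτ : 0 < τ.im) :
    theta 0 0 τ 0 * theta 0 1 τ 0 * theta 1 0 τ 0
      = 2 * e (1 / 8 * τ) * qPochhammerInf (e τ) (e τ) ^ 3 := by
  have h00 : theta 0 0 τ 0
      = qPochhammerInf (e τ) (e τ) * qPochhammerInf (-e (1 / 2 * τ)) (e τ) ^ 2 := by
    rw [theta_eq_jacobiTheta₂, jacobiTheta₂_eq_qPochhammerInf hτ]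
    simp only [Int.cast_zero, ne_eq, OfNat.ofNat_ne_zero, not_false_eq_true, zero_pow, zero_div,
      zero_mul, add_zero, mul_zero, e_zero, sub_zero, one_mul]
    ring
  have h01 : theta 0 1 τ 0
      = qPochhammerInf (e τ) (e τ) * qPochhammerInf (e (1 / 2 * τ)) (e τ) ^ 2 := by
    rw [theta_eq_jacobiTheta₂, jacobiTheta₂_eq_qPochhammerInf hτ,
      show (0 + ((1 : ℤ) : ℂ) / 2 + ((0 : ℤ) : ℂ) / 2 * τ) = 1 / 2 by push_cast; ring,
      e_add_half, e_sub_half]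
    simp only [Int.cast_zero, ne_eq, OfNat.ofNat_ne_zero, not_false_eq_true, zero_pow, zero_div,
      zero_mul, zero_add, e_zero, neg_neg, one_mul]
    ring
  have h10 : theta 1 0 τ 0
      = e (1 / 8 * τ) * qPochhammerInf (e τ) (e τ) * (2 * qPochhammerInf (-e τ) (e τ) ^ 2) := by
    rw [theta_eq_jacobiTheta₂, jacobiTheta₂_eq_qPochhammerInf hτ,
      show (0 + ((0 : ℤ) : ℂ) / 2 + ((1 : ℤ) : ℂ) / 2 * τ) = 1 / 2 * τ by push_cast; ring,
      sub_self, e_zero, ← add_mul, add_halves, one_mul,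
      qPochhammerInf_eq_mul (-1) (norm_e_lt_one hτ), neg_one_mul,
      show (((1 : ℤ) : ℂ) ^ 2 / 8 * τ + ((1 : ℤ) : ℂ) / 2 * (0 + ((0 : ℤ) : ℂ) / 2)) = 1 / 8 * τ by
        push_cast; ring]
    ring
  have h_euler := qPochhammerInf_euler (norm_e_half_mul_lt_one hτ)
  rw [e_half_mul_sq] at h_euler
  rw [h00, h01, h10]
  calc _ = 2 * e (1 / 8 * τ) * qPochhammerInf (e τ) (e τ) ^ 3
        * (qPochhammerInf (e (1 / 2 * τ)) (e τ) * qPochhammerInf (-e (1 / 2 * τ)) (e τ)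
          * qPochhammerInf (-e τ) (e τ)) ^ 2 := by ring
    _ = _ := by rw [h_euler, one_pow, mul_one]

lemma theta_zero_zero_mul_theta_zero_one_mul_theta_one_zero_ne_zero (hτ : 0 < τ.im) :
    theta 0 0 τ 0 * theta 0 1 τ 0 * theta 1 0 τ 0 ≠ 0 := by
  rw [theta_zero_zero_mul_theta_zero_one_mul_theta_one_zero hτ]
  exact mul_ne_zero (mul_ne_zero two_ne_zero (e_ne_zero _))
    (pow_ne_zero _ (qPochhammerInf_self_ne_zero (norm_e_lt_one hτ)))

/-- **Jacobi's derivative formula**: the limit is `ϑ₁₁'(0)`, as `ϑ₁₁` is odd. -/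
theorem tendsto_theta_one_one_div (hτ : 0 < τ.im) :
    Tendsto (fun z => theta 1 1 τ z / z) (𝓝[≠] 0)
      (𝓝 (-Real.pi * (theta 0 0 τ 0 * theta 0 1 τ 0 * theta 1 0 τ 0))) := by
  have hcont : Continuous fun z => -(Complex.I * e (1 / 8 * τ - 1 / 2 * z)) *
      (qPochhammerInf (e τ) (e τ) * qPochhammerInf (e (z + τ)) (e τ) *
        qPochhammerInf (e (-z + τ)) (e τ)) := by
    have := continuous_qPochhammerInf (norm_e_lt_one hτ)
    have := differentiable_e.continuous
    fun_prop
  have hlim := (hcont.continuousWithinAt (s := {0}ᶜ) (x := 0)).tendsto.mul tendsto_one_sub_e_div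
  convert hlim.congr fun z => ?_ using 2
  · rw [theta_zero_zero_mul_theta_zero_one_mul_theta_one_zero hτ]
    simp only [mul_zero, sub_zero, neg_zero, zero_add]
    linear_combination
      (-2 * Real.pi * e (1 / 8 * τ) * qPochhammerInf (e τ) (e τ) ^ 3) * Complex.I_sq
  · rw [theta_one_one_eq_qPochhammerInf hτ]
    ring

end ProductFormulas

section EllipticFunctions

lemma eventually_notMem_lattice (L : PeriodPair) (z₀ : ℂ) : ∀ᶠ z in 𝓝[≠] z₀, z ∉ L.lattice := by
  filter_upwards [nhdsWithin_le_nhds (L.compl_lattice_sdiff_singleton_mem_nhds z₀),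
    self_mem_nhdsWithin] with z hz hz₀ h
  exact hz ⟨h, hz₀⟩

lemma differentiable_of_periodic {L : PeriodPair} {f : ℂ → ℂ}
    (hper : ∀ ω ∈ L.lattice, Function.Periodic f ω)
    (hf : ∀ z ∉ L.lattice, DifferentiableAt ℂ f z) (hcont : ContinuousAt f 0) :
    Differentiable ℂ f := by
  have h_zero : DifferentiableAt ℂ f 0 :=
    (Complex.analyticAt_of_differentiable_on_punctured_nhds_of_continuousAt
      ((eventually_notMem_lattice L 0).mono hf) hcont).differentiableAt
  intro z
  by_cases hz : z ∈ L.lattice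
  · rw [show f = fun u => f (u - z) from funext fun u => ((hper z hz).sub_eq u).symm]
    refine DifferentiableAt.comp z (f := (· - z)) ?_ (by fun_prop)
    rwa [sub_self]
  · exact hf z hz

lemma isBounded_range_of_periodic {L : PeriodPair} {f : ℂ → ℂ}
    (hper : ∀ ω ∈ L.lattice, Function.Periodic f ω) (hf : Continuous f) :
    Bornology.IsBounded (Set.range f) := by
  have hK : IsCompact (closure (ZSpan.fundamentalDomain L.basis)) :=
    (ZSpan.fundamentalDomain_isBounded L.basis).isCompact_closure
  refine (hK.image hf).isBounded.subset ?_
  rintro _ ⟨z, rfl⟩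
  refine ⟨ZSpan.fract L.basis z, subset_closure (ZSpan.fract_mem_fundamentalDomain _ z), ?_⟩
  have h_floor : (ZSpan.floor L.basis z : ℂ) ∈ L.lattice := by
    rw [L.lattice_eq_span_range_basis]
    exact (ZSpan.floor L.basis z).2
  rw [ZSpan.fract_apply, (hper _ h_floor).sub_eq]

theorem eq_of_periodic_of_tendsto_zero {L : PeriodPair} {f : ℂ → ℂ} {c : ℂ}
    (hper : ∀ ω ∈ L.lattice, Function.Periodic f ω)
    (hf : ∀ z ∉ L.lattice, DifferentiableAt ℂ f z) (hlim : Tendsto f (𝓝[≠] 0) (𝓝 c))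
    {z : ℂ} (hz : z ∉ L.lattice) : f z = c := by
  classical
  set F : ℂ → ℂ := fun u => if u ∈ L.lattice then c else f u with hF
  have hF_off {u : ℂ} (hu : u ∉ L.lattice) : F u = f u := if_neg hu
  have hF_zero : F 0 = c := if_pos L.lattice.zero_mem
  have hF_per : ∀ ω ∈ L.lattice, Function.Periodic F ω := fun ω hω u => by
    simp only [hF, L.lattice.add_mem_iff_left hω, hper ω hω u]
  have hF_diff : Differentiable ℂ F := by
    refine differentiable_of_periodic hF_per (fun u hu => ?_) ?_
    · refine (hf u hu).congr_of_eventuallyEq ?_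
      filter_upwards [L.isClosed_lattice.isOpen_compl.mem_nhds hu] with v hv using hF_off hv
    · rw [continuousAt_iff_punctured_nhds, hF_zero]
      refine hlim.congr' ?_
      filter_upwards [eventually_notMem_lattice L 0] with u hu using (hF_off hu).symm
  rw [← hF_off hz, ← hF_zero]
  have hF_bounded := isBounded_range_of_periodic hF_per hF_diff.continuous
  exact hF_diff.apply_eq_apply_of_bounded hF_bounded z 0

end EllipticFunctions

section PeriodLattice

variable {τ : ℂ}

/-- The periods `1` and `τ` of the torus on which the theta functions `ϑ_{ab}(τ, ·)` live. -/
def periods (hτ : 0 < τ.im) : PeriodPair where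
  ω₁ := 1
  ω₂ := τ
  indep := by
    rw [LinearIndependent.pair_iff]
    intro s t h
    have ht : t = 0 := by simpa [hτ.ne'] using congrArg Complex.im h
    exact ⟨by simpa [ht] using congrArg Complex.re h, ht⟩

lemma mem_lattice_periods_iff (hτ : 0 < τ.im) {z : ℂ} :
    z ∈ (periods hτ).lattice ↔ ∃ m n : ℤ, m + n * τ = z := by
  rw [PeriodPair.mem_lattice]
  simp [periods]

lemma mem_lattice_periods_iff_exists_e_eq_one (hτ : 0 < τ.im) {z : ℂ} :
    z ∈ (periods hτ).lattice ↔ ∃ j : ℤ, e (z + j * τ) = 1 := by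
  simp only [mem_lattice_periods_iff, e_eq_one_iff]
  constructor
  · rintro ⟨m, n, rfl⟩
    exact ⟨-n, m, by push_cast; ring⟩
  · rintro ⟨j, m, h⟩
    exact ⟨m, -j, by push_cast; linear_combination -h⟩

lemma theta_one_one_ne_zero (hτ : 0 < τ.im) {z : ℂ} (hz : z ∉ (periods hτ).lattice) :
    theta 1 1 τ z ≠ 0 := by
  have h_nonzero {u : ℂ} (hu : u ∉ (periods hτ).lattice) (n : ℕ) :
      1 - e (u + τ) * e τ ^ n ≠ 0 := by
    rw [← e_nat_mul, ← e_add, sub_ne_zero]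
    refine fun h => hu ((mem_lattice_periods_iff_exists_e_eq_one hτ).2 ⟨n + 1, ?_⟩)
    rw [h]
    push_cast
    ring_nf
  have h_one : 1 - e z ≠ 0 := by
    rw [sub_ne_zero]
    exact fun h => hz ((mem_lattice_periods_iff_exists_e_eq_one hτ).2 ⟨0, by simpa using h.symm⟩)
  rw [theta_one_one_eq_qPochhammerInf hτ]
  have hq := norm_e_lt_one hτ
  have h_factor (u : ℂ) : -(Complex.I * e u) ≠ 0 :=
    neg_ne_zero.2 (mul_ne_zero Complex.I_ne_zero (e_ne_zero u))
  exact mul_ne_zero (mul_ne_zero (h_factor _) h_one)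
    (mul_ne_zero (mul_ne_zero (qPochhammerInf_self_ne_zero hq)
      (qPochhammerInf_ne_zero hq (h_nonzero hz)))
      (qPochhammerInf_ne_zero hq (h_nonzero (mt neg_mem_iff.1 hz))))

lemma periodic_of_mem_lattice_periods (hτ : 0 < τ.im) {f : ℂ → ℂ} (h_one : Function.Periodic f 1)
    (h_tau : Function.Periodic f τ) {ω : ℂ} (hω : ω ∈ (periods hτ).lattice) :
    Function.Periodic f ω := by
  obtain ⟨m, n, rfl⟩ := (mem_lattice_periods_iff hτ).1 hω
  simpa using (h_one.int_mul m).add_period (h_tau.int_mul n)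

end PeriodLattice

section OddQuasiPeriodic

lemma exists_tendsto_div_of_odd {D : ℂ → ℂ} (hd : ∀ᶠ z in 𝓝[≠] 0, DifferentiableAt ℂ D z)
    (hodd : D.Odd) (h0 : Tendsto (fun z => z * D z) (𝓝[≠] 0) (𝓝 0)) :
    ∃ l, Tendsto (fun z => D z / z) (𝓝[≠] 0) (𝓝 l) := by
  have hD0 : D 0 = 0 := hodd.map_zero
  have h_isLittleO : (fun z => D z - D 0) =o[𝓝[≠] 0] fun z => (z - 0)⁻¹ := by
    rw [Asymptotics.isLittleO_iff_tendsto']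
    · simpa [hD0, mul_comm] using h0
    · filter_upwards [self_mem_nhdsWithin] with z hz h
      exact absurd (by simpa using h) hz
  have hlim :=
    Complex.tendsto_limUnder_of_differentiable_on_punctured_nhds_of_isLittleO hd h_isLittleO
  have h_neg : Tendsto (fun z : ℂ => -z) (𝓝[≠] 0) (𝓝[≠] 0) := by
    simpa using (continuous_neg.continuousWithinAt (s := {0}ᶜ) (x := 0)).tendsto_nhdsWithin
      (t := {0}ᶜ) fun z (hz : z ≠ (0 : ℂ)) => neg_ne_zero.2 hz
  have h_limUnder : limUnder (𝓝[≠] 0) D = 0 :=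
    self_eq_neg.1 <| tendsto_nhds_unique (hlim.comp h_neg) (hlim.neg.congr fun z => (hodd z).symm)
  have hcont : ContinuousAt D 0 := by
    rw [h_limUnder] at hlim
    rwa [continuousAt_iff_punctured_nhds, hD0]
  have hdiff := (Complex.analyticAt_of_differentiable_on_punctured_nhds_of_continuousAt
    hd hcont).differentiableAt
  refine ⟨deriv D 0, (hasDerivAt_iff_tendsto_slope_zero.1 hdiff.hasDerivAt).congr fun z => ?_⟩
  rw [zero_add, hD0, sub_zero, smul_eq_mul, div_eq_inv_mul]

variable {τ : ℂ}

lemma periodic_div_theta_one_one_sq {D : ℂ → ℂ} {ε : ℂ} (hε : ε ^ 2 = 1)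
    (h_one : ∀ z, D (z + 1) = ε * D z) (h_tau : ∀ z, D (z + τ) = e (-z - 1 / 2 * τ) * D z) :
    Function.Periodic (fun z => (D z / theta 1 1 τ z) ^ 2) 1 ∧
      Function.Periodic (fun z => (D z / theta 1 1 τ z) ^ 2) τ := by
  refine ⟨fun z => ?_, fun z => ?_⟩ <;> dsimp only
  · rw [h_one, theta_add_one, Int.cast_one, e_half, mul_div_mul_comm, mul_pow, div_pow, hε]
    norm_num
  · have h_factor : e (-z - ((1 : ℤ) : ℂ) / 2 - 1 / 2 * τ) = -e (-z - 1 / 2 * τ) := by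
      rw [← e_sub_half, Int.cast_one, sub_right_comm]
    rw [h_tau, theta_add_tau, h_factor, neg_mul, div_neg, neg_sq,
      mul_div_mul_left _ _ (e_ne_zero _)]

theorem eq_zero_of_odd_of_quasiperiodic (hτ : 0 < τ.im) {D : ℂ → ℂ} {ε : ℂ} (hε : ε ^ 2 = 1)
    (hd : ∀ z ∉ (periods hτ).lattice, DifferentiableAt ℂ D z) (hodd : D.Odd)
    (h_one : ∀ z, D (z + 1) = ε * D z) (h_tau : ∀ z, D (z + τ) = e (-z - 1 / 2 * τ) * D z)
    (h0 : Tendsto (fun z => z * D z) (𝓝[≠] 0) (𝓝 0)) {z : ℂ} (hz : z ∉ (periods hτ).lattice) :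
    D z = 0 := by
  have hθ {u : ℂ} (hu : u ∉ (periods hτ).lattice) := theta_one_one_ne_zero hτ hu
  obtain ⟨l, hl⟩ : ∃ l, Tendsto (fun z => (D z / theta 1 1 τ z) ^ 2) (𝓝[≠] 0) (𝓝 l) := by
    obtain ⟨l, hl⟩ :=
      exists_tendsto_div_of_odd ((eventually_notMem_lattice (periods hτ) 0).mono hd) hodd h0
    have h_quot := hl.div (tendsto_theta_one_one_div hτ) (mul_ne_zero (by simp [Real.pi_ne_zero])
      (theta_zero_zero_mul_theta_zero_one_mul_theta_one_zero_ne_zero hτ))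
    refine ⟨_, (h_quot.pow 2).congr' ?_⟩
    filter_upwards [self_mem_nhdsWithin] with u hu
    rw [Pi.div_apply, div_div_div_cancel_right₀ hu]
  obtain ⟨hper_one, hper_tau⟩ := periodic_div_theta_one_one_sq hε h_one h_tau
  have h_const {u : ℂ} (hu : u ∉ (periods hτ).lattice) : (D u / theta 1 1 τ u) ^ 2 = l :=
    eq_of_periodic_of_tendsto_zero
      (fun ω hω => periodic_of_mem_lattice_periods hτ hper_one hper_tau hω)
      (fun v hv => ((hd v hv).div (differentiable_theta hτ 1 1 v) (hθ hv)).pow 2) hl hu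
  have hD_half : D (τ / 2) = 0 := by
    have h := h_tau (-(τ / 2))
    rw [hodd, show -(-(τ / 2)) - 1 / 2 * τ = 0 by ring, e_zero, one_mul,
      show -(τ / 2) + τ = τ / 2 by ring] at h
    exact self_eq_neg.1 h
  have hl_zero : l = 0 := by
    rw [← h_const (periods hτ).ω₂_div_two_notMem_lattice, show (periods hτ).ω₂ = τ from rfl,
      hD_half, zero_div, zero_pow two_ne_zero]
  have h := h_const hz
  rw [hl_zero, pow_eq_zero_iff two_ne_zero, div_eq_zero_iff] at h
  exact h.resolve_right (hθ hz)

end OddQuasiPeriodic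

/-- The `j`-th term of the Appell sum `appell s τ z`; its denominator is `1 - e(z) q ^ j`. -/
def appellTerm (s τ z : ℂ) (j : ℤ) : ℂ :=
  e ((j + s) * z + ((j : ℂ) ^ 2 / 2 + s * j) * τ) / (1 - e (z + j * τ))

/-- The Appell sum `∑_j e((j + s) z) q ^ (j ^ 2 / 2 + s j) / (1 - e(z) q ^ j)`. For half-integral
`s` it is, up to a power of `q`, a shift of the left-hand sides of the eight formulas. -/
def appell (s τ z : ℂ) : ℂ := ∑' j : ℤ, appellTerm s τ z j

section AppellQuasiPeriods

variable (s τ z : ℂ)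

lemma appell_neg : appell s τ (-z) = -appell (1 - s) τ z := by
  rw [appell, appell, ← tsum_neg, ← (Equiv.neg ℤ).tsum_eq]
  refine tsum_congr fun j => ?_
  have h_denom : 1 - e (-z + ((-j : ℤ) : ℂ) * τ) = -((1 - e (z + j * τ)) / e (z + j * τ)) := by
    rw [show -z + ((-j : ℤ) : ℂ) * τ = -(z + j * τ) by push_cast; ring, e_neg, sub_div,
      div_self (e_ne_zero _), one_div, neg_sub]
  rw [Equiv.neg_apply, appellTerm, appellTerm, h_denom, div_neg, div_div_eq_mul_div, ← e_add]
  push_cast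
  ring_nf

lemma appell_add_tau : appell s τ (z + τ) = e (-z - 1 / 2 * τ) * appell s τ z := by
  rw [appell, appell, ← tsum_mul_left, eq_comm, ← (Equiv.addRight (1 : ℤ)).tsum_eq]
  refine tsum_congr fun j => ?_
  rw [appellTerm, appellTerm, Equiv.coe_addRight, ← mul_div_assoc, ← e_add]
  push_cast
  ring_nf

lemma appell_add_one : appell s τ (z + 1) = e s * appell s τ z := by
  rw [appell, appell, ← tsum_mul_left]
  refine tsum_congr fun j => ?_
  rw [appellTerm, appellTerm, ← mul_div_assoc, ← e_add, ← e_add_int (s + _) j,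
    ← e_add_int (z + _) 1]
  push_cast
  ring_nf

end AppellQuasiPeriods

section AppellConvergence

lemma differentiableOn_tsum_of_eventually_norm_le {ι : Type*} {f : ι → ℂ → ℂ} {u : ι → ℝ}
    {V : Set ℂ} (hu : Summable u) (hV : IsOpen V) (hf : ∀ i, DifferentiableOn ℂ (f i) V)
    (hle : ∀ᶠ i in cofinite, ∀ z ∈ V, ‖f i z‖ ≤ u i) :
    DifferentiableOn ℂ (fun z => ∑' i, f i z) V := by
  set S := hle.toFinset
  have h_tail : DifferentiableOn ℂ (fun z => ∑' i : ((S : Set ι)ᶜ : Set ι), f i z) V := by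
    refine Complex.differentiableOn_tsum_of_summable_norm (hu.subtype _) (fun i => hf i) hV ?_
    rintro ⟨i, hi⟩ z hz
    exact not_not.1 (mt (Set.Finite.mem_toFinset hle).2 hi) z hz
  refine ((DifferentiableOn.fun_sum fun i (_ : i ∈ S) => hf i).add h_tail).congr fun z hz => ?_
  have h_summable : Summable fun i => f i z :=
    .of_norm_bounded_eventually hu (hle.mono fun i hi => hi z hz)
  exact h_summable.sum_add_tsum_compl.symm

lemma norm_inv_one_sub_e_le {u : ℂ} (hu : 1 ≤ |u.im|) : ‖(1 - e u)⁻¹‖ ≤ 2 := by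
  have h_exp : (2 : ℝ) ≤ Real.exp 1 := by linarith [Real.add_one_le_exp (1 : ℝ)]
  have h_half : 2⁻¹ ≤ ‖1 - e u‖ := by
    rcases le_abs'.1 hu with h | h
    · have h_big : 2 ≤ ‖e u‖ := by
        rw [norm_e]
        exact h_exp.trans (Real.exp_le_exp.2 (by nlinarith [Real.pi_gt_three]))
      rw [norm_sub_rev]
      linarith [norm_sub_norm_le (e u) 1, norm_one (α := ℂ)]
    · have h_small : ‖e u‖ ≤ 2⁻¹ := by
        rw [norm_e, Real.exp_neg]
        exact inv_anti₀ two_pos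
          (h_exp.trans (Real.exp_le_exp.2 (by nlinarith [Real.pi_gt_three])))
      linarith [norm_sub_norm_le 1 (e u), norm_one (α := ℂ)]
  rw [norm_inv]
  exact inv_le_of_inv_le₀ two_pos h_half

variable {τ : ℂ}

lemma eventually_one_le_abs_im_add_mul (hτ : 0 < τ.im) (B : ℝ) :
    ∀ᶠ j : ℤ in cofinite, ∀ z : ℂ, |z.im| ≤ B → 1 ≤ |(z + j * τ).im| := by
  have h_atTop : Tendsto (fun j : ℤ => |(j : ℝ)|) cofinite atTop :=
    tendsto_norm_cocompact_atTop.comp Int.tendsto_coe_cofinite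
  filter_upwards [h_atTop.eventually_ge_atTop ((B + 1) / τ.im)] with j hj z hz
  rw [div_le_iff₀ hτ] at hj
  have h_im : (z + j * τ).im = z.im + j * τ.im := by simp
  have h_abs : |(j : ℝ) * τ.im| = |(j : ℝ)| * τ.im := by rw [abs_mul, abs_of_pos hτ]
  have h_triangle := abs_sub_abs_le_abs_sub ((j : ℝ) * τ.im) (-z.im)
  rw [abs_neg, sub_neg_eq_add, add_comm (_ * _)] at h_triangle
  rw [h_im]
  linarith

lemma appellTerm_eq_mul_jacobiTheta₂_term (s τ z : ℂ) (j : ℤ) :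
    appellTerm s τ z j
      = e (s * z) * jacobiTheta₂_term j (z + s * τ) τ * (1 - e (z + j * τ))⁻¹ := by
  rw [appellTerm, jacobiTheta₂_term_eq_e, ← e_add, div_eq_mul_inv]
  ring_nf

lemma exists_summable_eventually_norm_appellTerm_le (hτ : 0 < τ.im) (s z₀ : ℂ) :
    ∃ u : ℤ → ℝ, Summable u ∧
      ∀ᶠ j in cofinite, ∀ z ∈ Metric.ball z₀ 1, ‖appellTerm s τ z j‖ ≤ u j := by
  have he := differentiable_e.continuous
  obtain ⟨C, hC⟩ := (isCompact_closedBall z₀ 1).exists_bound_of_continuousOn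
    (f := fun z => e (s * z)) (by fun_prop)
  set B := |z₀.im| + 1 with hB
  have h_im : ∀ z ∈ Metric.ball z₀ 1, |z.im| ≤ B := fun z hz => by
    have h := (Complex.abs_im_le_norm (z - z₀)).trans (mem_ball_iff_norm.1 hz).le
    rw [Complex.sub_im] at h
    linarith [abs_sub_abs_le_abs_sub z.im z₀.im, hB]
  set b : ℤ → ℝ := fun j =>
    Real.exp (-Real.pi * (τ.im * j ^ 2 - 2 * (B + |(s * τ).im|) * |j|)) with hb
  have h_summable : Summable b := by
    simpa [hb] using summable_pow_mul_jacobiTheta₂_term_bound (B + |(s * τ).im|) hτ 0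
  refine ⟨fun j => C * b j * 2, (h_summable.mul_left C).mul_right 2, ?_⟩
  filter_upwards [eventually_one_le_abs_im_add_mul hτ B] with j hj z hz
  have h_shift : |(z + s * τ).im| ≤ B + |(s * τ).im| := by
    rw [Complex.add_im]
    linarith [abs_add_le z.im (s * τ).im, h_im z hz]
  have h_term : ‖jacobiTheta₂_term j (z + s * τ) τ‖ ≤ b j :=
    norm_jacobiTheta₂_term_le hτ h_shift le_rfl j
  have h_factor := hC z (Metric.ball_subset_closedBall hz)
  have hC0 : 0 ≤ C := (norm_nonneg _).trans h_factor
  rw [appellTerm_eq_mul_jacobiTheta₂_term, norm_mul, norm_mul]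
  gcongr
  exact norm_inv_one_sub_e_le (hj z (h_im z hz))

lemma summable_appellTerm (hτ : 0 < τ.im) (s z : ℂ) : Summable (appellTerm s τ z) := by
  obtain ⟨u, hu, hle⟩ := exists_summable_eventually_norm_appellTerm_le hτ s z
  exact .of_norm_bounded_eventually hu
    (hle.mono fun j hj => hj z (Metric.mem_ball_self one_pos))

lemma differentiableAt_tsum_appellTerm (hτ : 0 < τ.im) (s : ℂ) (J : Set ℤ) {z₀ : ℂ}
    (h : ∀ᶠ z in 𝓝 z₀, ∀ j ∈ J, e (z + j * τ) ≠ 1) :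
    DifferentiableAt ℂ (fun z => ∑' j : J, appellTerm s τ z j) z₀ := by
  obtain ⟨V, hV, hV_open, hz₀⟩ := eventually_nhds_iff.1 h
  obtain ⟨u, hu, hle⟩ := exists_summable_eventually_norm_appellTerm_le hτ s z₀
  have he := differentiable_e
  have h_diff (j : J) : DifferentiableOn ℂ (fun z => appellTerm s τ z j)
      (V ∩ Metric.ball z₀ 1) := fun z hz => by
    refine DifferentiableAt.differentiableWithinAt (.div (by fun_prop) (by fun_prop) ?_)
    exact sub_ne_zero.2 (hV z hz.1 j j.2).symm
  refine (differentiableOn_tsum_of_eventually_norm_le (hu.comp_injective Subtype.val_injective)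
    (hV_open.inter Metric.isOpen_ball) h_diff ?_).differentiableAt
    ((hV_open.inter Metric.isOpen_ball).mem_nhds ⟨hz₀, Metric.mem_ball_self one_pos⟩)
  exact (Subtype.val_injective.tendsto_cofinite.eventually hle).mono fun j hj z hz => hj z hz.2

lemma differentiableAt_appell (hτ : 0 < τ.im) (s : ℂ) {z : ℂ} (hz : z ∉ (periods hτ).lattice) :
    DifferentiableAt ℂ (appell s τ) z := by
  rw [show appell s τ = fun z => ∑' j : (Set.univ : Set ℤ), appellTerm s τ z j from
    funext fun z => (tsum_univ (appellTerm s τ z)).symm]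
  refine differentiableAt_tsum_appellTerm hτ s Set.univ ?_
  filter_upwards [(periods hτ).isClosed_lattice.isOpen_compl.mem_nhds hz] with u hu j _ h
  exact hu ((mem_lattice_periods_iff_exists_e_eq_one hτ).2 ⟨j, h⟩)

lemma tendsto_mul_appell (hτ : 0 < τ.im) (s : ℂ) :
    Tendsto (fun z => z * appell s τ z) (𝓝[≠] 0) (𝓝 (-(2 * Real.pi * Complex.I))⁻¹) := by
  have h_regular : DifferentiableAt ℂ
      (fun z => ∑' j : ({0}ᶜ : Set ℤ), appellTerm s τ z j) 0 := by
    refine differentiableAt_tsum_appellTerm hτ s {0}ᶜ ?_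
    filter_upwards [(periods hτ).compl_lattice_sdiff_singleton_mem_nhds 0] with z hz j hj h
    have hz0 : z = 0 := by_contra fun hz0 =>
      hz ⟨(mem_lattice_periods_iff_exists_e_eq_one hτ).2 ⟨j, h⟩, hz0⟩
    rw [hz0, zero_add, e_eq_one_iff] at h
    obtain ⟨n, hn⟩ := h
    exact hj (by simpa [hτ.ne'] using congrArg Complex.im hn)
  have h_rest : Tendsto (fun z => z * ∑' j : ({0}ᶜ : Set ℤ), appellTerm s τ z j)
      (𝓝[≠] 0) (𝓝 0) := by
    simpa using (continuousAt_id.fun_mul h_regular.continuousAt).tendsto.mono_left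
      (nhdsWithin_le_nhds (s := {0}ᶜ))
  have h_pole : Tendsto (fun z => e (s * z) * ((1 - e z) / z)⁻¹) (𝓝[≠] 0)
      (𝓝 (-(2 * Real.pi * Complex.I))⁻¹) := by
    have h_cont : Continuous fun z => e (s * z) := by
      have := differentiable_e.continuous
      fun_prop
    simpa [e_zero] using (h_cont.continuousWithinAt (s := {0}ᶜ) (x := 0)).tendsto.mul
      (tendsto_one_sub_e_div.inv₀ (neg_ne_zero.2 Complex.two_pi_I_ne_zero))
  rw [← add_zero (-_)⁻¹]
  refine (h_pole.add h_rest).congr fun z => ?_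
  rw [appell, ← (summable_appellTerm hτ s z).tsum_subtype_add_tsum_subtype_compl {0},
    tsum_singleton, mul_add, appellTerm]
  simp only [inv_div, Int.cast_zero, zero_add, ne_eq, OfNat.ofNat_ne_zero, not_false_eq_true,
    zero_pow, zero_div, mul_zero, add_zero, zero_mul]
  ring

end AppellConvergence

/-- The theta quotient `-i ϑ_{a0}(τ, 0) ϑ₀₁(τ, z) ϑ_{1-a,0}(τ, z) / ϑ₁₁(τ, z)` that is the closed
form of the symmetrised Appell sum `appell (a / 2) τ z + appell (1 - a / 2) τ z`. -/
def thetaQuotient (a : ℤ) (τ z : ℂ) : ℂ :=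
  -Complex.I * theta a 0 τ 0 * (theta 0 1 τ z * theta (1 - a) 0 τ z / theta 1 1 τ z)

section ThetaQuotient

variable (a : ℤ) (τ z : ℂ)

lemma thetaQuotient_add_two_mul (k : ℤ) :
    thetaQuotient (a + 2 * k) τ z = thetaQuotient a τ z := by
  rw [thetaQuotient, thetaQuotient, show 1 - (a + 2 * k) = 1 - a + 2 * -k by ring]
  simp only [theta_add_two_mul_left]

lemma odd_thetaQuotient : (thetaQuotient a τ).Odd := fun z => by
  rw [thetaQuotient, thetaQuotient, theta_one_one_neg, theta_zero_right_neg, theta_zero_left_neg,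
    div_neg, mul_neg]

lemma thetaQuotient_add_one : thetaQuotient a τ (z + 1) = e (a / 2) * thetaQuotient a τ z := by
  have h_sign : e (((1 - a : ℤ) : ℂ) / 2) = -e (a / 2) := by
    rw [← e_add_half, ← e_add_int _ a]
    push_cast
    ring_nf
  rw [thetaQuotient, thetaQuotient, theta_add_one, theta_add_one, theta_add_one, h_sign,
    Int.cast_zero, zero_div, e_zero, Int.cast_one, e_half]
  ring

lemma thetaQuotient_add_tau :
    thetaQuotient a τ (z + τ) = e (-z - 1 / 2 * τ) * thetaQuotient a τ z := by
  rw [thetaQuotient, thetaQuotient, theta_add_tau, theta_add_tau, theta_add_tau, mul_assoc (e _),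
    mul_div_mul_left _ _ (e_ne_zero _), Int.cast_zero, zero_div, sub_zero]
  ring

lemma theta_zero_mul_theta_one_sub_zero :
    theta a 0 τ 0 * theta (1 - a) 0 τ 0 = theta 0 0 τ 0 * theta 1 0 τ 0 := by
  obtain ⟨k, rfl | rfl⟩ := Int.even_or_odd' a
  · rw [← theta_add_two_mul_left 0 0 τ 0 k, ← theta_add_two_mul_left 1 0 τ 0 (-k)]
    ring_nf
  · rw [← theta_add_two_mul_left 1 0 τ 0 k, ← theta_add_two_mul_left 0 0 τ 0 (-k)]
    ring_nf

variable {τ z}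

lemma differentiableAt_thetaQuotient (hτ : 0 < τ.im) (hz : z ∉ (periods hτ).lattice) :
    DifferentiableAt ℂ (thetaQuotient a τ) z := by
  have hθ (a b : ℤ) := differentiable_theta hτ a b z
  exact (((hθ 0 1).mul (hθ (1 - a) 0)).div (hθ 1 1) (theta_one_one_ne_zero hτ hz)).const_mul _

lemma tendsto_mul_thetaQuotient (hτ : 0 < τ.im) :
    Tendsto (fun z => z * thetaQuotient a τ z) (𝓝[≠] 0) (𝓝 (Complex.I / Real.pi)) := by
  have h_cont : Continuous fun z =>
      -Complex.I * theta a 0 τ 0 * (theta 0 1 τ z * theta (1 - a) 0 τ z) := by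
    have hθ (a b : ℤ) := (differentiable_theta hτ a b).continuous
    fun_prop
  have h_ne_zero := theta_zero_zero_mul_theta_zero_one_mul_theta_one_zero_ne_zero hτ
  have h_lim := (h_cont.continuousWithinAt (s := {0}ᶜ) (x := 0)).tendsto.div
    (tendsto_theta_one_one_div hτ)
    (mul_ne_zero (neg_ne_zero.2 (Complex.ofReal_ne_zero.2 Real.pi_ne_zero)) h_ne_zero)
  have h_numerator : -Complex.I * theta a 0 τ 0 * (theta 0 1 τ 0 * theta (1 - a) 0 τ 0)
      = -Complex.I * (theta 0 0 τ 0 * theta 0 1 τ 0 * theta 1 0 τ 0) := by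
    linear_combination
      (-Complex.I * theta 0 1 τ 0) * theta_zero_mul_theta_one_sub_zero a τ
  rw [h_numerator, mul_div_mul_right _ _ h_ne_zero, neg_div_neg_eq] at h_lim
  refine h_lim.congr fun z => ?_
  rw [Pi.div_apply, div_div_eq_mul_div, thetaQuotient]
  ring

end ThetaQuotient

section ClosedForm

variable {τ z : ℂ}

theorem appell_add_appell_one_sub (hτ : 0 < τ.im) (c : ℤ) (hz : z ∉ (periods hτ).lattice) :
    appell (c / 2) τ z + appell (1 - c / 2) τ z = thetaQuotient c τ z := by
  have h_multiplier : e (1 - c / 2) = e (c / 2) := by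
    rw [← e_add_int _ (c - 1)]
    push_cast
    ring_nf
  refine sub_eq_zero.1 <| eq_zero_of_odd_of_quasiperiodic hτ (ε := e (c / 2))
    (D := fun z => appell (c / 2) τ z + appell (1 - c / 2) τ z - thetaQuotient c τ z)
    ?sq_eq_one (fun u hu => ?differentiable) (fun u => ?odd) (fun u => ?add_one) (fun u => ?add_tau)
    ?tendsto hz
  case sq_eq_one => rw [← e_nat_mul, Nat.cast_ofNat, mul_div_cancel₀ _ two_ne_zero, e_int]
  case differentiable =>
    exact ((differentiableAt_appell hτ _ hu).add (differentiableAt_appell hτ _ hu)).sub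
      (differentiableAt_thetaQuotient c hτ hu)
  case odd =>
    simp only [appell_neg, sub_sub_cancel, odd_thetaQuotient c τ u]
    ring
  case add_one =>
    simp only [appell_add_one, thetaQuotient_add_one, h_multiplier]
    ring
  case add_tau =>
    simp only [appell_add_tau, thetaQuotient_add_tau]
    ring
  case tendsto =>
    have h_residue : (-(2 * Real.pi * Complex.I))⁻¹ + (-(2 * Real.pi * Complex.I))⁻¹
        - Complex.I / Real.pi = 0 := by
      have h_pi : (Real.pi : ℂ) ≠ 0 := Complex.ofReal_ne_zero.2 Real.pi_ne_zero
      field_simp [Complex.I_ne_zero]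
      rw [Complex.I_sq]
      norm_num
    simpa only [mul_add, mul_sub, h_residue] using
      ((tendsto_mul_appell hτ _).add (tendsto_mul_appell hτ _)).sub (tendsto_mul_thetaQuotient c hτ)

lemma appell_sub_appell_add_one (hτ : 0 < τ.im) (c : ℤ) (hz : z ∉ (periods hτ).lattice) :
    appell (c / 2) τ z - appell (c / 2 + 1) τ z
      = e (-(c / 2 : ℂ) ^ 2 / 2 * τ) * theta c 0 τ z := by
  rw [appell, appell, ← (summable_appellTerm hτ _ z).tsum_sub (summable_appellTerm hτ _ z),
    theta_eq_tsum_e, ← tsum_mul_left]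
  refine tsum_congr fun j => ?_
  have h_denom : 1 - e (z + j * τ) ≠ 0 := sub_ne_zero.2 fun h =>
    hz ((mem_lattice_periods_iff_exists_e_eq_one hτ).2 ⟨j, h.symm⟩)
  have h_next : e ((j + (c / 2 + 1)) * z + ((j : ℂ) ^ 2 / 2 + (c / 2 + 1) * j) * τ)
      = e ((j + c / 2) * z + ((j : ℂ) ^ 2 / 2 + c / 2 * j) * τ) * e (z + j * τ) := by
    rw [← e_add]
    ring_nf
  rw [appellTerm, appellTerm, h_next, ← sub_div, ← mul_one_sub, mul_div_cancel_right₀ _ h_denom,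
    ← e_add]
  push_cast
  ring_nf

theorem two_mul_appell_neg_half (hτ : 0 < τ.im) (c : ℕ) (hz : z ∉ (periods hτ).lattice) :
    2 * appell (-(c / 2)) τ z = thetaQuotient c τ z
      + ∑ k ∈ Finset.range (c + 1), e (-(k - c / 2 : ℂ) ^ 2 / 2 * τ) * theta c 0 τ z := by
  have h_step (k : ℕ) : appell (k - c / 2) τ z - appell ((k + 1 : ℕ) - c / 2) τ z
      = e (-(k - c / 2 : ℂ) ^ 2 / 2 * τ) * theta c 0 τ z := by
    have h := appell_sub_appell_add_one hτ (c + 2 * (k - c)) hz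
    rw [theta_add_two_mul_left] at h
    convert h using 3 <;> push_cast <;> ring_nf
  have h_telescope : appell (-(c / 2)) τ z - appell (1 - -(c / 2)) τ z
      = ∑ k ∈ Finset.range (c + 1), e (-(k - c / 2 : ℂ) ^ 2 / 2 * τ) * theta c 0 τ z := by
    rw [← Finset.sum_congr rfl fun k _ => h_step k,
      Finset.sum_range_sub' fun k : ℕ => appell (k - c / 2) τ z]
    push_cast
    ring_nf
  have h_symm := appell_add_appell_one_sub hτ (-c) hz
  rw [show (-c : ℤ) = c + 2 * -c by ring, thetaQuotient_add_two_mul] at h_symm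
  push_cast at h_symm
  rw [show (c + 2 * -c : ℂ) / 2 = -(c / 2) by ring] at h_symm
  linear_combination h_symm + h_telescope

lemma two_mul_appell_neg_add_half (hτ : 0 < τ.im) (a n : ℕ) (hz : z ∉ (periods hτ).lattice) :
    2 * appell (-(n + a / 2)) τ z = thetaQuotient a τ z
      + ∑ k ∈ Finset.range (2 * n + a + 1),
          qpow τ (-(k - n - a / 2) ^ 2 / 2) * theta a 0 τ z := by
  have h_half : ((2 * n + a : ℕ) : ℂ) / 2 = n + a / 2 := by
    push_cast
    ring
  have h_parity : ((2 * n + a : ℕ) : ℤ) = a + 2 * n := by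
    push_cast
    ring
  have h := two_mul_appell_neg_half hτ (2 * n + a) hz
  simpa only [h_half, h_parity, thetaQuotient_add_two_mul, theta_add_two_mul_left, qpow_eq_e,
    sub_sub] using h

end ClosedForm

section Formulas

variable {τ : ℂ}

lemma e_mul_qpow (τ u r : ℂ) : e u * qpow τ r = e (u + r * τ) := by rw [qpow_eq_e, e_add]

lemma neg_one_zpow_eq_e (j : ℤ) : (-1 : ℂ) ^ j = e (j / 2) := by
  rw [← e_half, ← e_int_mul, mul_one_div]

lemma summable_and_two_mul_tsum_of_eq_mul {f g : ℤ → ℂ} {R : ℂ} (κ : ℂ)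
    (hf : Summable f ∧ 2 * ∑' j, f j = R) (hg : ∀ j, g j = κ * f j) :
    Summable g ∧ 2 * ∑' j, g j = κ * R := by
  rw [funext hg]
  exact ⟨hf.1.mul_left κ, by rw [tsum_mul_left, mul_left_comm, hf.2]⟩

theorem two_mul_tsum_integral_shift (hτ : 0 < τ.im) (a n : ℕ) {z : ℂ}
    (h : ∀ j : ℤ, 1 - e z * qpow τ (j + n) ≠ 0) :
    theta 1 1 τ z ≠ 0 ∧
      Summable (fun j : ℤ => e ((j - a / 2) * z) * qpow τ ((j - a / 2) ^ 2 / 2)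
        / (1 - e z * qpow τ (j + n))) ∧
      2 * ∑' j : ℤ, e ((j - a / 2) * z) * qpow τ ((j - a / 2) ^ 2 / 2)
          / (1 - e z * qpow τ (j + n))
        = qpow τ ((n + a / 2) ^ 2 / 2) * (-Complex.I * theta a 0 τ 0
            * (theta 0 1 τ z * theta (1 - a) 0 τ z / theta 1 1 τ z)
          + ∑ k ∈ Finset.range (2 * n + a + 1),
              qpow τ (-(k - n - a / 2) ^ 2 / 2) * theta a 0 τ z) := by
  have hz : z ∉ (periods hτ).lattice := fun h_mem => by
    obtain ⟨j, hj⟩ := (mem_lattice_periods_iff_exists_e_eq_one hτ).1 h_mem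
    refine h (j - n) ?_
    rw [e_mul_qpow, Int.cast_sub, Int.cast_natCast, sub_add_cancel, hj, sub_self]
  refine ⟨theta_one_one_ne_zero hτ hz, ?_⟩
  have h_appell : Summable (fun j : ℤ => appellTerm (-(n + a / 2)) τ z (j + n : ℤ)) ∧
      2 * ∑' j : ℤ, appellTerm (-(n + a / 2)) τ z (j + n : ℤ) = thetaQuotient a τ z
        + ∑ k ∈ Finset.range (2 * n + a + 1),
            qpow τ (-(k - n - a / 2) ^ 2 / 2) * theta a 0 τ z :=
    ⟨(Equiv.addRight (n : ℤ)).summable_iff.2 (summable_appellTerm hτ _ z), by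
      rw [← two_mul_appell_neg_add_half hτ a n hz, appell,
        ← (Equiv.addRight (n : ℤ)).tsum_eq (appellTerm _ τ z)]
      rfl⟩
  refine summable_and_two_mul_tsum_of_eq_mul (qpow τ ((n + a / 2) ^ 2 / 2)) h_appell fun j => ?_
  rw [appellTerm, e_mul_qpow, e_mul_qpow, ← mul_div_assoc, qpow_eq_e, ← e_add]
  push_cast
  ring_nf

theorem two_mul_tsum_half_integral_shift (hτ : 0 < τ.im) (a n : ℕ) {z : ℂ}
    (h : ∀ j : ℤ, 1 - e z * qpow τ (j + n + 1 / 2) ≠ 0) :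
    theta 0 1 τ z ≠ 0 ∧
      Summable (fun j : ℤ => e ((j + (1 - a) / 2) * z) * qpow τ ((j + (1 - a) / 2) ^ 2 / 2)
        / (1 - e z * qpow τ (j + n + 1 / 2))) ∧
      2 * ∑' j : ℤ, e ((j + (1 - a) / 2) * z) * qpow τ ((j + (1 - a) / 2) ^ 2 / 2)
          / (1 - e z * qpow τ (j + n + 1 / 2))
        = qpow τ ((n + a / 2) ^ 2 / 2) * (-Complex.I * theta a 0 τ 0
            * (theta a 0 τ z * theta 1 1 τ z / theta 0 1 τ z)
          + ∑ k ∈ Finset.range (2 * n + a + 1),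
              qpow τ (-(k - n - a / 2) ^ 2 / 2) * theta (1 - a) 0 τ z) := by
  have h_denom (j : ℂ) : e (z + 1 / 2 * τ) * qpow τ (j + n) = e z * qpow τ (j + n + 1 / 2) := by
    rw [e_mul_qpow, e_mul_qpow]
    ring_nf
  obtain ⟨h_ne_zero, h_sum⟩ := two_mul_tsum_integral_shift hτ a n (z := z + 1 / 2 * τ)
    (fun j => h_denom j ▸ h j)
  set κ := e (-(1 / 8 * τ) - 1 / 2 * z) with hκ
  have hκ_ne_zero : κ ≠ 0 := e_ne_zero _
  have h_zero (c d : ℤ) (hcd : c + 1 = d + 2 * c) :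
      theta c 0 τ (z + 1 / 2 * τ) = κ * theta d 0 τ z := by
    rw [theta_add_tau_half, hcd, theta_add_two_mul_left, Int.cast_zero, zero_div, sub_zero]
  have h_one (c : ℤ) : theta c 1 τ (z + 1 / 2 * τ) = κ * -Complex.I * theta (c + 1) 1 τ z := by
    rw [theta_add_tau_half, hκ, sub_eq_add_neg, e_add, e_neg, Int.cast_one, e_quarter,
      Complex.inv_I]
  have h_one_one : theta 1 1 τ (z + 1 / 2 * τ) = κ * -Complex.I * theta 0 1 τ z := by
    rw [h_one, ← theta_add_two_mul_left 0 1 τ z 1]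
    rfl
  rw [h_one_one] at h_ne_zero h_sum
  refine ⟨right_ne_zero_of_mul h_ne_zero, ?_⟩
  convert summable_and_two_mul_tsum_of_eq_mul κ⁻¹ h_sum fun j => ?term using 2
  case term =>
    simp only [h_denom, e_mul_qpow, hκ, ← e_neg, ← mul_div_assoc, ← e_add]
    ring_nf
  rw [h_one, h_zero a (1 - a) (by ring), h_zero (1 - a) a (by ring), zero_add, ← Finset.sum_mul,
    ← Finset.sum_mul]
  field_simp [Complex.I_ne_zero]

lemma theta_zero_one_add_half (τ z : ℂ) : theta 0 1 τ (z + 1 / 2) = theta 0 0 τ z := by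
  rw [theta_add_half, ← zero_add (1 + 1 : ℤ), one_add_one_eq_two, theta_add_two_right,
    Int.cast_zero, zero_div, e_zero, one_mul]

lemma theta_one_one_add_half (τ z : ℂ) : theta 1 1 τ (z + 1 / 2) = -theta 1 0 τ z := by
  rw [theta_add_half, ← zero_add (1 + 1 : ℤ), one_add_one_eq_two, theta_add_two_right,
    Int.cast_one, e_half, neg_one_mul]

lemma one_sub_e_add_half_mul (z w : ℂ) : 1 - e (z + 1 / 2) * w = 1 + e z * w := by
  rw [e_add_half, neg_mul, sub_neg_eq_add]

theorem two_mul_tsum_alternating_integral_shift (hτ : 0 < τ.im) (a n : ℕ) {z : ℂ}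
    (h : ∀ j : ℤ, 1 + e z * qpow τ (j + n) ≠ 0) :
    theta 1 0 τ z ≠ 0 ∧
      Summable (fun j : ℤ => (-1) ^ j * (e ((j - a / 2) * z) * qpow τ ((j - a / 2) ^ 2 / 2))
        / (1 + e z * qpow τ (j + n))) ∧
      2 * ∑' j : ℤ, (-1) ^ j * (e ((j - a / 2) * z) * qpow τ ((j - a / 2) ^ 2 / 2))
          / (1 + e z * qpow τ (j + n))
        = qpow τ ((n + a / 2) ^ 2 / 2) * (Complex.I ^ (a + 1) * theta a 0 τ 0
            * (theta 0 0 τ z * theta (1 - a) 1 τ z / theta 1 0 τ z)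
          + Complex.I ^ a * ∑ k ∈ Finset.range (2 * n + a + 1),
              qpow τ (-(k - n - a / 2) ^ 2 / 2) * theta a 1 τ z) := by
  obtain ⟨h_ne_zero, h_sum⟩ := two_mul_tsum_integral_shift hτ a n (z := z + 1 / 2)
    (fun j => one_sub_e_add_half_mul z _ ▸ h j)
  simp only [theta_one_one_add_half, theta_zero_one_add_half, theta_add_half _ 0, zero_add,
    one_sub_e_add_half_mul] at h_ne_zero h_sum
  refine ⟨neg_ne_zero.1 h_ne_zero, ?_⟩
  convert summable_and_two_mul_tsum_of_eq_mul (Complex.I ^ a) h_sum fun j => ?term using 2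
  case term =>
    rw [← mul_div_assoc, neg_one_zpow_eq_e, ← e_quarter, ← e_nat_mul, ← mul_assoc, ← mul_assoc,
      ← e_add, ← e_add]
    ring_nf
  rw [div_neg]
  ring

theorem two_mul_tsum_alternating_half_integral_shift (hτ : 0 < τ.im) (a n : ℕ) {z : ℂ}
    (h : ∀ j : ℤ, 1 + e z * qpow τ (j + n + 1 / 2) ≠ 0) :
    theta 0 0 τ z ≠ 0 ∧
      Summable (fun j : ℤ => (-1) ^ j
        * (e ((j + (1 - a) / 2) * z) * qpow τ ((j + (1 - a) / 2) ^ 2 / 2))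
        / (1 + e z * qpow τ (j + n + 1 / 2))) ∧
      2 * ∑' j : ℤ, (-1) ^ j * (e ((j + (1 - a) / 2) * z) * qpow τ ((j + (1 - a) / 2) ^ 2 / 2))
          / (1 + e z * qpow τ (j + n + 1 / 2))
        = qpow τ ((n + a / 2) ^ 2 / 2) * (Complex.I ^ a * theta a 0 τ 0
            * (theta a 1 τ z * theta 1 0 τ z / theta 0 0 τ z)
          + Complex.I ^ (a - 1 : ℤ) * ∑ k ∈ Finset.range (2 * n + a + 1),
              qpow τ (-(k - n - a / 2) ^ 2 / 2) * theta (1 - a) 1 τ z) := by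
  obtain ⟨h_ne_zero, h_sum⟩ := two_mul_tsum_half_integral_shift hτ a n (z := z + 1 / 2)
    (fun j => one_sub_e_add_half_mul z _ ▸ h j)
  simp only [theta_one_one_add_half, theta_zero_one_add_half, theta_add_half _ 0, zero_add,
    one_sub_e_add_half_mul] at h_ne_zero h_sum
  refine ⟨h_ne_zero, ?_⟩
  convert summable_and_two_mul_tsum_of_eq_mul (Complex.I ^ (a - 1 : ℤ)) h_sum fun j => ?term
    using 2
  case term =>
    rw [← mul_div_assoc, neg_one_zpow_eq_e, ← e_quarter, ← e_int_mul, ← mul_assoc, ← mul_assoc,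
      ← e_add, ← e_add]
    push_cast
    ring_nf
  rw [zpow_sub_one₀ Complex.I_ne_zero, zpow_natCast, Complex.inv_I]
  linear_combination (qpow τ ((n + a / 2) ^ 2 / 2) * Complex.I ^ a * theta a 0 τ 0
    * (theta a 1 τ z * theta 1 0 τ z / theta 0 0 τ z)) * Complex.I_sq

end Formulas

end

end AppellSum

open AppellSum in
theorem mainTheorem3 (n : ℕ) (τ z : ℂ) (hτ : 0 < τ.im) :
    ((∀ j : ℤ, 1 - e z * qpow τ ((j : ℂ) + n) ≠ 0) →
      theta 1 1 τ z ≠ 0 ∧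
      Summable (fun j : ℤ => (e ((j : ℂ) * z) * qpow τ ((j : ℂ) ^ 2 / 2)) / (1 - e z * qpow τ ((j : ℂ) + n))) ∧
      2 * ∑' j : ℤ, (e ((j : ℂ) * z) * qpow τ ((j : ℂ) ^ 2 / 2)) / (1 - e z * qpow τ ((j : ℂ) + n))
        = qpow τ ((n : ℂ) ^ 2 / 2) * (-Complex.I * theta 0 0 τ 0 * (theta 0 1 τ z * theta 1 0 τ z / theta 1 1 τ z)
            + ∑ k ∈ Finset.range (2 * n + 1),
              qpow τ (-((k : ℂ) - n) ^ 2 / 2) * theta 0 0 τ z)) ∧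
    ((∀ j : ℤ, 1 - e z * qpow τ ((j : ℂ) + n) ≠ 0) →
      theta 1 1 τ z ≠ 0 ∧
      Summable (fun j : ℤ => (e (((j : ℂ) - 1 / 2) * z) * qpow τ (((j : ℂ) - 1 / 2) ^ 2 / 2)) / (1 - e z * qpow τ ((j : ℂ) + n))) ∧
      2 * ∑' j : ℤ, (e (((j : ℂ) - 1 / 2) * z) * qpow τ (((j : ℂ) - 1 / 2) ^ 2 / 2)) / (1 - e z * qpow τ ((j : ℂ) + n))
        = qpow τ (((n : ℂ) + 1 / 2) ^ 2 / 2) * (-Complex.I * theta 1 0 τ 0 * (theta 0 1 τ z * theta 0 0 τ z / theta 1 1 τ z)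
            + ∑ k ∈ Finset.range (2 * n + 2),
              qpow τ (-((k : ℂ) - n - 1 / 2) ^ 2 / 2) * theta 1 0 τ z)) ∧
    ((∀ j : ℤ, 1 - e z * qpow τ ((j : ℂ) + n + 1 / 2) ≠ 0) →
      theta 0 1 τ z ≠ 0 ∧
      Summable (fun j : ℤ => (e ((j : ℂ) * z) * qpow τ ((j : ℂ) ^ 2 / 2)) / (1 - e z * qpow τ ((j : ℂ) + n + 1 / 2))) ∧
      2 * ∑' j : ℤ, (e ((j : ℂ) * z) * qpow τ ((j : ℂ) ^ 2 / 2)) / (1 - e z * qpow τ ((j : ℂ) + n + 1 / 2))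
        = qpow τ (((n : ℂ) + 1 / 2) ^ 2 / 2) * (-Complex.I * theta 1 0 τ 0 * (theta 1 0 τ z * theta 1 1 τ z / theta 0 1 τ z)
            + ∑ k ∈ Finset.range (2 * n + 2),
              qpow τ (-((k : ℂ) - n - 1 / 2) ^ 2 / 2) * theta 0 0 τ z)) ∧
    ((∀ j : ℤ, 1 - e z * qpow τ ((j : ℂ) + n + 1 / 2) ≠ 0) →
      theta 0 1 τ z ≠ 0 ∧
      Summable (fun j : ℤ => (e (((j : ℂ) + 1 / 2) * z) * qpow τ (((j : ℂ) + 1 / 2) ^ 2 / 2)) / (1 - e z * qpow τ ((j : ℂ) + n + 1 / 2))) ∧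
      2 * ∑' j : ℤ, (e (((j : ℂ) + 1 / 2) * z) * qpow τ (((j : ℂ) + 1 / 2) ^ 2 / 2)) / (1 - e z * qpow τ ((j : ℂ) + n + 1 / 2))
        = qpow τ ((n : ℂ) ^ 2 / 2) * (-Complex.I * theta 0 0 τ 0 * (theta 0 0 τ z * theta 1 1 τ z / theta 0 1 τ z)
            + ∑ k ∈ Finset.range (2 * n + 1),
              qpow τ (-((k : ℂ) - n) ^ 2 / 2) * theta 1 0 τ z)) ∧
    ((∀ j : ℤ, 1 + e z * qpow τ ((j : ℂ) + n) ≠ 0) →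
      theta 1 0 τ z ≠ 0 ∧
      Summable (fun j : ℤ => (-1 : ℂ) ^ j * (e ((j : ℂ) * z) * qpow τ ((j : ℂ) ^ 2 / 2)) / (1 + e z * qpow τ ((j : ℂ) + n))) ∧
      2 * ∑' j : ℤ, (-1 : ℂ) ^ j * (e ((j : ℂ) * z) * qpow τ ((j : ℂ) ^ 2 / 2)) / (1 + e z * qpow τ ((j : ℂ) + n))
        = qpow τ ((n : ℂ) ^ 2 / 2) * (Complex.I * theta 0 0 τ 0 * (theta 0 0 τ z * theta 1 1 τ z / theta 1 0 τ z)
            + ∑ k ∈ Finset.range (2 * n + 1),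
              qpow τ (-((k : ℂ) - n) ^ 2 / 2) * theta 0 1 τ z)) ∧
    ((∀ j : ℤ, 1 + e z * qpow τ ((j : ℂ) + n) ≠ 0) →
      theta 1 0 τ z ≠ 0 ∧
      Summable (fun j : ℤ => (-1 : ℂ) ^ j * (e (((j : ℂ) - 1 / 2) * z) * qpow τ (((j : ℂ) - 1 / 2) ^ 2 / 2)) / (1 + e z * qpow τ ((j : ℂ) + n))) ∧
      2 * ∑' j : ℤ, (-1 : ℂ) ^ j * (e (((j : ℂ) - 1 / 2) * z) * qpow τ (((j : ℂ) - 1 / 2) ^ 2 / 2)) / (1 + e z * qpow τ ((j : ℂ) + n))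
        = qpow τ (((n : ℂ) + 1 / 2) ^ 2 / 2) * (-theta 1 0 τ 0 * (theta 0 1 τ z * theta 0 0 τ z / theta 1 0 τ z)
            + Complex.I * ∑ k ∈ Finset.range (2 * n + 2),
              qpow τ (-((k : ℂ) - n - 1 / 2) ^ 2 / 2) * theta 1 1 τ z)) ∧
    ((∀ j : ℤ, 1 + e z * qpow τ ((j : ℂ) + n + 1 / 2) ≠ 0) →
      theta 0 0 τ z ≠ 0 ∧
      Summable (fun j : ℤ => (-1 : ℂ) ^ j * (e ((j : ℂ) * z) * qpow τ ((j : ℂ) ^ 2 / 2)) / (1 + e z * qpow τ ((j : ℂ) + n + 1 / 2))) ∧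
      2 * ∑' j : ℤ, (-1 : ℂ) ^ j * (e ((j : ℂ) * z) * qpow τ ((j : ℂ) ^ 2 / 2)) / (1 + e z * qpow τ ((j : ℂ) + n + 1 / 2))
        = qpow τ (((n : ℂ) + 1 / 2) ^ 2 / 2) * (Complex.I * theta 1 0 τ 0 * (theta 1 1 τ z * theta 1 0 τ z / theta 0 0 τ z)
            + ∑ k ∈ Finset.range (2 * n + 2),
              qpow τ (-((k : ℂ) - n - 1 / 2) ^ 2 / 2) * theta 0 1 τ z)) ∧
    ((∀ j : ℤ, 1 + e z * qpow τ ((j : ℂ) + n + 1 / 2) ≠ 0) →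
      theta 0 0 τ z ≠ 0 ∧
      Summable (fun j : ℤ => (-1 : ℂ) ^ j * (e (((j : ℂ) + 1 / 2) * z) * qpow τ (((j : ℂ) + 1 / 2) ^ 2 / 2)) / (1 + e z * qpow τ ((j : ℂ) + n + 1 / 2))) ∧
      2 * ∑' j : ℤ, (-1 : ℂ) ^ j * (e (((j : ℂ) + 1 / 2) * z) * qpow τ (((j : ℂ) + 1 / 2) ^ 2 / 2)) / (1 + e z * qpow τ ((j : ℂ) + n + 1 / 2))
        = qpow τ ((n : ℂ) ^ 2 / 2) * (theta 0 0 τ 0 * (theta 0 1 τ z * theta 1 0 τ z / theta 0 0 τ z)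
            - Complex.I * ∑ k ∈ Finset.range (2 * n + 1),
              qpow τ (-((k : ℂ) - n) ^ 2 / 2) * theta 1 1 τ z)) := by
  refine ⟨fun h => ?_, fun h => ?_, fun h => ?_, fun h => ?_, fun h => ?_, fun h => ?_,
    fun h => ?_, fun h => ?_⟩
  · simpa using two_mul_tsum_integral_shift hτ 0 n h
  · simpa using two_mul_tsum_integral_shift hτ 1 n h
  · simpa using two_mul_tsum_half_integral_shift hτ 1 n h
  · simpa using two_mul_tsum_half_integral_shift hτ 0 n h
  · simpa using two_mul_tsum_alternating_integral_shift hτ 0 n h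
  · simpa [mul_comm (theta 0 1 τ z)] using two_mul_tsum_alternating_integral_shift hτ 1 n h
  · simpa using two_mul_tsum_alternating_half_integral_shift hτ 1 n h
  · simpa [sub_eq_add_neg] using two_mul_tsum_alternating_half_integral_shift hτ 0 n h
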